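/- **Setting.** Let $A\in\mathbb R^{p\times p}$ be invertible, $\Sigma_1,\Sigma_w\in\mathbb R^{p\times p}$ symmetric positive definite, and let $x_{k+1}=Ax_k+w_k$ ($k=1,\dots,n$), where $x_1\sim N(0,\Sigma_1)$ and $w_k\sim N(0,\Sigma_w)$ are all independent; put $\Sigma_{k+1}=A\Sigma_kA'+\Sigma_w$. At stage $k=1,\dots,n$ a sender transmits $y_k=\eta_k(x_1,\dots,x_k)\in\mathbb R^p$ and a receiver then takes the action $u_k=\gamma_k(y_1,\dots,y_k)\in\mathbb R^t$; all $\eta_k$, $\gamma_k$ are arbitrary Borel-measurable functions. The costs of the sender and of the receiver are $J_i(\eta;\gamma)=\mathbb E\sum_{k=1}^n\|Q_{i,k}x_k+R_{i,k}u_k\|^2$, $i\in\{S,R\}$, with $Q_{i,k}\in\mathbb R^{r\times p}$, $R_{i,k}\in\mathbb R^{r\times t}$ and $R_{R,k}'R_{R,k}$ positive definite. A best response to $\eta$ is a $\gamma$ that minimizes $J_R(\eta;\cdot)$. A pair $(\eta^*,\gamma^*(\cdot))$ is a Stackelberg equilibrium if $\gamma^*(\eta)$ is a best response to every $\eta$ and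 $\eta^*$ minimizes $J_S(\eta;\gamma^*(\eta))$ over all Borel-measurable sender policies $\eta$. For a sender policy $\eta$ let $\hat x_k=\mathbb E[x_k\mid y_1,\dots,y_k]$ and let $H_k$ be the covariance matrix of $\hat x_k$. Put $\Lambda^0_k=R_{S,k}(R_{R,k}'R_{R,k})^{-1}R_{R,k}'Q_{R,k}$ and $V_k=(\Lambda^0_k)'\Lambda^0_k-(\Lambda^0_k)'Q_{S,k}-Q_{S,k}'\Lambda^0_k$. The semidefinite program (SDP) is to minimize $\sum_{k=1}^n\operatorname{tr}(V_kS_k)$ over symmetric $S_1,\dots,S_n\in\mathbb R^{p\times p}$ subject to $\Sigma_k\succeq S_k\succeq AS_{k-1}A'$ for $k=1,\dots,n$, where $S_0=0$. **Theorem.** Let $S_1^*,\dots,S_n^*$ be a solution of the SDP (with $S_0^*=0$) and let $P_1,\dots,P_n$ be corresponding symmetric idempotent matrices, that is, for all $k=1,\dots,n$, $$S_k^*=AS_{k-1}^*A'+(\Sigma_k-AS_{k-1}^*A')^{1/2}P_k(\Sigma_k-AS_{k-1}^*A')^{1/2}.$$ Let $P_k=U_k\Lambda_kU_k'$ be eigendecompositions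 ($U_k$ orthogonal, $\Lambda_k$ diagonal) and put $L_k=(\Sigma_k-AS_{k-1}^*A')^{-1/2}U_k\Lambda_k$. Let $\eta^*$ be the memoryless linear sender policy $\eta_k^*(x_1,\dots,x_k)=L_k'x_k$. Then: 1. under $\eta^*$ the posterior covariances are $H_k=S_k^*$ for all $k$; 2. every Borel-measurable sender policy satisfies $\sum_k\mathbb E[\hat x_k'V_k\hat x_k]\ge\sum_k\operatorname{tr}(V_kS_k^*)$, with equality for $\eta^*$; 3. for every map $\gamma^*(\cdot)$ that selects a best response of the receiver to each sender policy, $(\eta^*,\gamma^*(\cdot))$ is a Stackelberg equilibrium; 4. all best responses of the receiver to $\eta^*$ produce almost surely the same actions, and these are linear: $u_k=\sum_{i\le k}G_{k,i}y_i$ for some matrices $G_{k,i}$. There is a Stackelberg equilibrium $(\eta^*,\gamma^*(\cdot))$ in which $\gamma^*(\eta^*)$ is this linear policy and $\gamma_k^*(\eta)$ depends on $\eta_1,\dots,\eta_k$ only. -/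

import Mathlib

open MeasureTheory ProbabilityTheory Matrix

namespace SignalingGame

noncomputable section

/-- Euclidean space `ℝᵖ`. -/
abbrev Vec (p : ℕ) : Type := EuclideanSpace ℝ (Fin p)

open scoped MatrixOrder in
/-- The positive semidefinite square root `M^{1/2}` of a positive semidefinite matrix. -/
def msqrt {p : ℕ} (M : Matrix (Fin p) (Fin p) ℝ) : Matrix (Fin p) (Fin p) ℝ :=
  CFC.sqrt M

/-- The data of an `n`-stage Gaussian strategic communication game with states in `ℝᵖ`, receiver
actions in `ℝᵗ` and costs in `ℝʳ`. The stages `1, …, n` of the game are indexed by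
`0, …, n - 1`. -/
structure Game (n p t r : ℕ) where
  A : Matrix (Fin p) (Fin p) ℝ
  Sigma1 : Matrix (Fin p) (Fin p) ℝ
  SigmaW : Matrix (Fin p) (Fin p) ℝ
  QS : Fin n → Matrix (Fin r) (Fin p) ℝ
  RS : Fin n → Matrix (Fin r) (Fin t) ℝ
  QR : Fin n → Matrix (Fin r) (Fin p) ℝ
  RR : Fin n → Matrix (Fin r) (Fin t) ℝ
  isUnit_det_A : IsUnit A.det
  posDef_Sigma1 : Sigma1.PosDef
  posDef_SigmaW : SigmaW.PosDef
  posDef_RR : ∀ k, ((RR k)ᵀ * RR k).PosDef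

/-- The sender's policies: the message of stage `k` is a function of the states up to stage `k`. -/
abbrev SenderPolicy (n p : ℕ) : Type :=
  (k : Fin n) → (Fin (k + 1) → Vec p) → Vec p

/-- The receiver's policies: the action of stage `k` is a function of the messages up to
stage `k`. -/
abbrev ReceiverPolicy (n p t : ℕ) : Type :=
  (k : Fin n) → (Fin (k + 1) → Vec p) → Vec t

/-- The sender's policy space: all Borel measurable policies. -/
def SenderPolicy.Admissible {n p : ℕ} (η : SenderPolicy n p) : Prop :=
  ∀ k, Measurable (η k)

/-- The receiver's policy space: all Borel measurable policies. -/
def ReceiverPolicy.Admissible {n p t : ℕ} (γ : ReceiverPolicy n p t) : Prop :=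
  ∀ k, Measurable (γ k)

/-- The memoryless linear sender policy `η_k(x_1, …, x_k) = L_k' x_k`. -/
def memorylessLinear {n p : ℕ} (L : Fin n → Matrix (Fin p) (Fin p) ℝ) : SenderPolicy n p :=
  fun k h => WithLp.toLp 2 ((L k)ᵀ *ᵥ (h (Fin.last k)).ofLp)

/-- The linear receiver policy `γ_k(y_1, …, y_k) = ∑_{i ≤ k} G_{k,i} y_i`. -/
def linearReceiver {n p t : ℕ}
    (G : (k : Fin n) → Fin (k + 1) → Matrix (Fin t) (Fin p) ℝ) : ReceiverPolicy n p t :=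
  fun k h => ∑ i, WithLp.toLp 2 (G k i *ᵥ (h i).ofLp)

/-- The term `S_{k-1}` of a sequence `S_1, …, S_n`, with the convention `S_0 = 0`. -/
def prev {n p : ℕ} (S : Fin n → Matrix (Fin p) (Fin p) ℝ) (k : Fin n) :
    Matrix (Fin p) (Fin p) ℝ :=
  if (k : ℕ) = 0 then 0 else S ⟨k - 1, by omega⟩

namespace Game

variable {n p t r : ℕ} (g : Game n p t r)

/-- The state covariances: `Σ_1` is given and `Σ_{k+1} = A Σ_k A' + Σ_w`. -/
def stateCov : ℕ → Matrix (Fin p) (Fin p) ℝ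
  | 0 => g.Sigma1
  | k + 1 => g.A * stateCov k * g.Aᵀ + g.SigmaW

/-- `Λ_k = R_{S,k} (R_{R,k}' R_{R,k})⁻¹ R_{R,k}' Q_{R,k}`. -/
def lam (k : Fin n) : Matrix (Fin r) (Fin p) ℝ :=
  g.RS k * ((g.RR k)ᵀ * g.RR k)⁻¹ * (g.RR k)ᵀ * g.QR k

/-- `V_k = Λ_k' Λ_k - Λ_k' Q_{S,k} - Q_{S,k}' Λ_k`. -/
def V (k : Fin n) : Matrix (Fin p) (Fin p) ℝ :=
  (g.lam k)ᵀ * g.lam k - (g.lam k)ᵀ * g.QS k - (g.QS k)ᵀ * g.lam k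

/-! ### The semidefinite program -/

/-- `Σ_k - A S_{k-1} A'`, with `S_0 = 0`. -/
def gap (S : Fin n → Matrix (Fin p) (Fin p) ℝ) (k : Fin n) : Matrix (Fin p) (Fin p) ℝ :=
  g.stateCov k - g.A * prev S k * g.Aᵀ

/-- The constraints of the semidefinite program: symmetric matrices with
`Σ_k ⪰ S_k ⪰ A S_{k-1} A'` for all `k`, where `S_0 = 0`. -/
def sdpFeasible : Set (Fin n → Matrix (Fin p) (Fin p) ℝ) :=
  {S | ∀ k, (S k).IsSymm ∧ (g.stateCov k - S k).PosSemidef ∧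
    (S k - g.A * prev S k * g.Aᵀ).PosSemidef}

/-- The objective `∑_k tr(V_k S_k)` of the semidefinite program. -/
def sdpObjective (S : Fin n → Matrix (Fin p) (Fin p) ℝ) : ℝ :=
  ∑ k, (g.V k * S k).trace

/-- `S` is a (global) solution of the semidefinite program. -/
def IsSDPSolution (S : Fin n → Matrix (Fin p) (Fin p) ℝ) : Prop :=
  S ∈ g.sdpFeasible ∧ IsMinOn g.sdpObjective g.sdpFeasible S

/-! ### The stochastic model -/

variable {Ω : Type*} [MeasurableSpace Ω]

/-- `x_1, …, x_{n+1}` is the state process driven by the noise `w_1, …, w_n`: the initial state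
`x_1 ∼ N(0, Σ_1)` and the noises `w_k ∼ N(0, Σ_w)` are independent random vectors, and
`x_{k+1} = A x_k + w_k`. -/
structure IsStateModel (μ : Measure Ω) (x : Fin (n + 1) → Ω → Vec p) (w : Fin n → Ω → Vec p) :
    Prop where
  measurable_init : Measurable (x 0)
  measurable_noise : ∀ k, Measurable (w k)
  law_init : μ.map (x 0) = multivariateGaussian 0 g.Sigma1
  law_noise : ∀ k, μ.map (w k) = multivariateGaussian 0 g.SigmaW
  indep : iIndepFun (Fin.cons (α := fun _ => Ω → Vec p) (x 0) w) μ
  step : ∀ (k : Fin n) (ω : Ω),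
    x k.succ ω = WithLp.toLp 2 (g.A *ᵥ (x k.castSucc ω).ofLp) + w k ω

end Game

section Signals

variable {n p t r : ℕ} {Ω : Type*}

/-- The message `y_k = η_k(x_1, …, x_k)`. -/
def message (x : Fin (n + 1) → Ω → Vec p) (η : SenderPolicy n p) (k : Fin n) (ω : Ω) : Vec p :=
  η k fun i => x ⟨i, by omega⟩ ω

/-- The messages `(y_1, …, y_k)` available to the receiver at stage `k`. -/
def messages (x : Fin (n + 1) → Ω → Vec p) (η : SenderPolicy n p) (k : Fin n) (ω : Ω) :
    Fin (k + 1) → Vec p :=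
  fun i => message x η ⟨i, by omega⟩ ω

/-- The action `u_k = γ_k(y_1, …, y_k)`. -/
def action (x : Fin (n + 1) → Ω → Vec p) (η : SenderPolicy n p) (γ : ReceiverPolicy n p t)
    (k : Fin n) (ω : Ω) : Vec t :=
  γ k (messages x η k ω)

variable [MeasurableSpace Ω]

/-- The posterior `x̂_k = E[x_k | y_1, …, y_k]`. -/
def posterior (μ : Measure Ω) (x : Fin (n + 1) → Ω → Vec p) (η : SenderPolicy n p) (k : Fin n) :
    Ω → Vec p :=
  μ[x k.castSucc | MeasurableSpace.comap (messages x η k) inferInstance]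

/-- The posterior covariance `H_k`, the covariance matrix of `x̂_k`. -/
def posteriorCov (μ : Measure Ω) (x : Fin (n + 1) → Ω → Vec p) (η : SenderPolicy n p)
    (k : Fin n) : Matrix (Fin p) (Fin p) ℝ :=
  Matrix.of fun i j => cov[fun ω => posterior μ x η k ω i, fun ω => posterior μ x η k ω j; μ]

end Signals

namespace Game

variable {n p t r : ℕ} (g : Game n p t r) {Ω : Type*} [MeasurableSpace Ω]

/-- The sender's cost `J_S = E ∑_k ‖Q_{S,k} x_k + R_{S,k} u_k‖²`, possibly infinite. -/
def senderCost (μ : Measure Ω) (x : Fin (n + 1) → Ω → Vec p) (η : SenderPolicy n p)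
    (γ : ReceiverPolicy n p t) : ENNReal :=
  ∫⁻ ω, ∑ k : Fin n, ENNReal.ofReal (‖(WithLp.toLp 2 (g.QS k *ᵥ (x k.castSucc ω).ofLp +
    g.RS k *ᵥ (action x η γ k ω).ofLp) : Vec r)‖ ^ 2) ∂μ

/-- The receiver's cost `J_R = E ∑_k ‖Q_{R,k} x_k + R_{R,k} u_k‖²`, possibly infinite. -/
def receiverCost (μ : Measure Ω) (x : Fin (n + 1) → Ω → Vec p) (η : SenderPolicy n p)
    (γ : ReceiverPolicy n p t) : ENNReal :=
  ∫⁻ ω, ∑ k : Fin n, ENNReal.ofReal (‖(WithLp.toLp 2 (g.QR k *ᵥ (x k.castSucc ω).ofLp +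
    g.RR k *ᵥ (action x η γ k ω).ofLp) : Vec r)‖ ^ 2) ∂μ

/-- `γ` is a best response of the receiver to `η`, i.e. it belongs to the reaction set of `η`. -/
def IsBestResponse (μ : Measure Ω) (x : Fin (n + 1) → Ω → Vec p) (η : SenderPolicy n p)
    (γ : ReceiverPolicy n p t) : Prop :=
  γ.Admissible ∧ ∀ γ' : ReceiverPolicy n p t, γ'.Admissible →
    g.receiverCost μ x η γ ≤ g.receiverCost μ x η γ'

/-- The map `Γ` selects a best response of the receiver to every admissible sender policy. -/
def IsReaction (μ : Measure Ω) (x : Fin (n + 1) → Ω → Vec p)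
    (Γ : SenderPolicy n p → ReceiverPolicy n p t) : Prop :=
  ∀ η : SenderPolicy n p, η.Admissible → g.IsBestResponse μ x η (Γ η)

/-- `(η, Γ)` attains the multi-stage Stackelberg equilibrium: `Γ` selects best responses of the
receiver, and `η` minimizes the sender's cost among all admissible policies when the receiver
reacts according to `Γ`. -/
def IsStackelbergEquilibrium (μ : Measure Ω) (x : Fin (n + 1) → Ω → Vec p)
    (η : SenderPolicy n p) (Γ : SenderPolicy n p → ReceiverPolicy n p t) : Prop :=
  η.Admissible ∧ g.IsReaction μ x Γ ∧
    ∀ η' : SenderPolicy n p, η'.Admissible →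
      g.senderCost μ x η (Γ η) ≤ g.senderCost μ x η' (Γ η')

/-- The sender's reduced objective `∑_k E[x̂_k' V_k x̂_k]`. -/
def posteriorObjective (μ : Measure Ω) (x : Fin (n + 1) → Ω → Vec p) (η : SenderPolicy n p) : ℝ :=
  ∑ k : Fin n, ∫ ω, (posterior μ x η k ω).ofLp ⬝ᵥ (g.V k *ᵥ (posterior μ x η k ω).ofLp) ∂μ

end Game

/-- The receiver's action at stage `k` depends only on the sender's policies up to stage `k`. -/
def IsCausal {n p t : ℕ} (Γ : SenderPolicy n p → ReceiverPolicy n p t) : Prop :=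
  ∀ (k : Fin n) (η η' : SenderPolicy n p), (∀ j ≤ k, η j = η' j) → Γ η k = Γ η' k

end

end SignalingGame

/-!
The receiver's problem is a least-squares problem at every stage: among the actions measurable with
respect to the messages, the cost `E‖Q x + R u‖²` is minimized exactly (almost surely) by
`u = -(R'R)⁻¹R'Q x̂`, where `x̂` is the posterior (`lintegral_cost_isLeast`, `isBestResponse_iff`).
Substituting this reaction, the sender's cost becomes a constant plus `∑ E[x̂' V x̂]`
(`senderCost_eq`), which is `∑ tr(V H)` for the posterior covariances `H`.

For an arbitrary measurable sender policy these covariances are feasible for the semidefinite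
program (`posteriorCov_mem_sdpFeasible`): conditioning decreases covariance matrices, so
`H_k ⪯ Σ_k`, and since the noise is independent of the past, the conditional expectation of `x̂_{k+1}` given the
messages up to stage `k` is `A x̂_k`, so `A H_k A' ⪯ H_{k+1}`. Hence the value of the program bounds
the reduced objective from below.

The bound is attained by the linear policy `y_k = L_k' x_k`. With the recursive linear estimates
`z_k = A x̂_{k-1} + G^{1/2} U (y_k - L_k' A x̂_{k-1})`, where `G = Σ_k - A S_{k-1} A'` is the
covariance of the prediction error, the error `x_k - z_k` is uncorrelated with all messages and has
covariance `Σ_k - S_k` (`HasLinearEstimate.update`, `HasLinearEstimate.predict`). States and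
messages are jointly Gaussian, so the error is independent of the messages and `z_k` is the
posterior (`posterior_ae_eq_of_uncorrelated`); therefore `H_k = S_k`, and the posterior is linear in
the messages.
-/

namespace SignalingGame

/-! ### Matrices acting on Euclidean space -/

/-- The continuous linear map `v ↦ M v` between Euclidean spaces. -/
noncomputable def mulVecL {a b : ℕ} (M : Matrix (Fin a) (Fin b) ℝ) : Vec b →L[ℝ] Vec a :=
  LinearMap.toContinuousLinearMap (Matrix.toLpLin 2 2 M)

section MulVecL

variable {a b c : ℕ}

lemma mulVecL_apply (M : Matrix (Fin a) (Fin b) ℝ) (v : Vec b) :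
    mulVecL M v = WithLp.toLp 2 (M *ᵥ v.ofLp) := rfl

@[simp]
lemma mulVecL_apply_apply (M : Matrix (Fin a) (Fin b) ℝ) (v : Vec b) (i : Fin a) :
    mulVecL M v i = ∑ j, M i j * v j := rfl

lemma mulVecL_mul (M : Matrix (Fin a) (Fin b) ℝ) (N : Matrix (Fin b) (Fin c) ℝ) (v : Vec c) :
    mulVecL (M * N) v = mulVecL M (mulVecL N v) := by
  simp [mulVecL_apply, Matrix.mulVec_mulVec]

@[simp]
lemma mulVecL_one (v : Vec a) : mulVecL (1 : Matrix (Fin a) (Fin a) ℝ) v = v := by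
  simp [mulVecL_apply]

lemma mulVecL_sub (M N : Matrix (Fin a) (Fin b) ℝ) (v : Vec b) :
    mulVecL (M - N) v = mulVecL M v - mulVecL N v := by
  simp [mulVecL_apply, Matrix.sub_mulVec]

lemma mulVecL_neg (M : Matrix (Fin a) (Fin b) ℝ) (v : Vec b) :
    mulVecL (-M) v = -mulVecL M v := by
  simp [mulVecL_apply, Matrix.neg_mulVec]

lemma inner_eq_dotProduct (u v : Vec a) : inner ℝ u v = u.ofLp ⬝ᵥ v.ofLp := by
  rw [EuclideanSpace.inner_eq_star_dotProduct, dotProduct_comm]; rfl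

lemma inner_mulVecL_left (M : Matrix (Fin a) (Fin b) ℝ) (u : Vec b) (v : Vec a) :
    inner ℝ (mulVecL M u) v = inner ℝ u (mulVecL Mᵀ v) := by
  rw [inner_eq_dotProduct, inner_eq_dotProduct, mulVecL_apply, mulVecL_apply,
    dotProduct_comm, Matrix.dotProduct_mulVec, dotProduct_comm, Matrix.mulVec_transpose]

end MulVecL

/-! ### Cross-covariance matrices -/

section CrossCov

variable {a b c : ℕ} {Ω : Type*} [MeasurableSpace Ω] {μ : Measure Ω}

/-- The matrix `Cov(X, Y)` of the covariances of the coordinates of two random vectors. -/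
noncomputable def crossCov (μ : Measure Ω) (X : Ω → Vec a) (Y : Ω → Vec b) :
    Matrix (Fin a) (Fin b) ℝ :=
  Matrix.of fun i j => cov[fun ω => X ω i, fun ω => Y ω j; μ]

lemma memLp_coord {X : Ω → Vec a} {q : ENNReal} (hX : MemLp X q μ) (i : Fin a) :
    MemLp (fun ω => X ω i) q μ :=
  (EuclideanSpace.proj (𝕜 := ℝ) i : Vec a →L[ℝ] ℝ).comp_memLp' hX

lemma memLp_mulVecL (M : Matrix (Fin a) (Fin b) ℝ) {X : Ω → Vec b} {q : ENNReal}
    (hX : MemLp X q μ) : MemLp (fun ω => mulVecL M (X ω)) q μ :=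
  (mulVecL M).comp_memLp' hX

lemma transpose_crossCov (X : Ω → Vec a) (Y : Ω → Vec b) :
    (crossCov μ X Y)ᵀ = crossCov μ Y X := by
  ext i j
  exact covariance_comm _ _

lemma crossCov_congr {X X' : Ω → Vec a} {Y Y' : Ω → Vec b} (hX : X =ᵐ[μ] X') (hY : Y =ᵐ[μ] Y') :
    crossCov μ X Y = crossCov μ X' Y' := by
  ext i j
  have h1 : (fun ω => X ω i) =ᵐ[μ] fun ω => X' ω i := hX.fun_comp (fun v : Vec a => v i)
  have h2 : (fun ω => Y ω j) =ᵐ[μ] fun ω => Y' ω j := hY.fun_comp (fun v : Vec b => v j)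
  simp only [crossCov, Matrix.of_apply, covariance]
  rw [integral_congr_ae h1, integral_congr_ae h2]
  refine integral_congr_ae ?_
  filter_upwards [h1, h2] with ω e1 e2
  rw [e1, e2]

lemma crossCov_eq_zero_of_indepFun {X : Ω → Vec a} {Y : Ω → Vec b} (hX : MemLp X 2 μ)
    (hY : MemLp Y 2 μ) (h : IndepFun X Y μ) : crossCov μ X Y = 0 := by
  ext i j
  have := h.comp (φ := fun v : Vec a => v i) (ψ := fun v : Vec b => v j) (by fun_prop) (by fun_prop)
  exact this.covariance_eq_zero (memLp_coord hX i) (memLp_coord hY j)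

/-- The expectation of a quadratic form of a centred random vector. -/
lemma integral_dotProduct_mulVec [IsProbabilityMeasure μ] {X : Ω → Vec a} (hX : MemLp X 2 μ)
    (h0 : ∫ ω, X ω ∂μ = 0) (M : Matrix (Fin a) (Fin a) ℝ) :
    ∫ ω, (X ω).ofLp ⬝ᵥ (M *ᵥ (X ω).ofLp) ∂μ = (M * crossCov μ X X).trace := by
  have hi : ∀ i, ∫ ω, X ω i ∂μ = 0 := fun i => by
    have := ContinuousLinearMap.integral_comp_comm
      (EuclideanSpace.proj (𝕜 := ℝ) i : Vec a →L[ℝ] ℝ) (hX.integrable one_le_two)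
    rw [h0, map_zero] at this
    exact this
  have hint : ∀ i j, Integrable (fun ω => X ω i * (M i j * X ω j)) μ := fun i j =>
    (memLp_coord hX i).integrable_mul ((memLp_coord hX j).const_mul _)
  simp only [dotProduct, mulVec, Finset.mul_sum]
  rw [integral_finsetSum _ fun i _ => integrable_finsetSum _ fun j _ => hint i j]
  simp only [Matrix.trace, Matrix.diag, Matrix.mul_apply]
  refine Finset.sum_congr rfl fun i _ => ?_
  rw [integral_finsetSum _ fun j _ => hint i j]
  refine Finset.sum_congr rfl fun j _ => ?_
  simp only [crossCov, Matrix.of_apply]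
  rw [covariance_eq_sub (memLp_coord hX j) (memLp_coord hX i), hi, hi, mul_zero, sub_zero,
    ← integral_const_mul]
  refine integral_congr_ae (.of_forall fun ω => ?_)
  simp only [Pi.mul_apply]
  ring

variable [IsFiniteMeasure μ]

lemma crossCov_add_left {X Y : Ω → Vec a} {Z : Ω → Vec b} (hX : MemLp X 2 μ) (hY : MemLp Y 2 μ)
    (hZ : MemLp Z 2 μ) :
    crossCov μ (fun ω => X ω + Y ω) Z = crossCov μ X Z + crossCov μ Y Z := by
  ext i j
  exact covariance_add_left (memLp_coord hX i) (memLp_coord hY i) (memLp_coord hZ j)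

lemma crossCov_add_right {X Y : Ω → Vec a} {Z : Ω → Vec b} (hX : MemLp X 2 μ) (hY : MemLp Y 2 μ)
    (hZ : MemLp Z 2 μ) :
    crossCov μ Z (fun ω => X ω + Y ω) = crossCov μ Z X + crossCov μ Z Y := by
  rw [← transpose_crossCov, crossCov_add_left hX hY hZ, transpose_add, transpose_crossCov,
    transpose_crossCov]

lemma crossCov_mulVecL_left (M : Matrix (Fin a) (Fin b) ℝ) {X : Ω → Vec b} {Z : Ω → Vec c}
    (hX : MemLp X 2 μ) (hZ : MemLp Z 2 μ) :
    crossCov μ (fun ω => mulVecL M (X ω)) Z = M * crossCov μ X Z := by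
  ext i j
  simp only [crossCov, Matrix.of_apply, Matrix.mul_apply, mulVecL_apply_apply]
  rw [covariance_fun_sum_left (fun l => (memLp_coord hX l).const_mul _) (memLp_coord hZ j)]
  simp only [covariance_const_mul_left]

lemma crossCov_mulVecL_right (M : Matrix (Fin a) (Fin b) ℝ) {X : Ω → Vec b} {Z : Ω → Vec c}
    (hX : MemLp X 2 μ) (hZ : MemLp Z 2 μ) :
    crossCov μ Z (fun ω => mulVecL M (X ω)) = crossCov μ Z X * Mᵀ := by
  rw [← transpose_crossCov, crossCov_mulVecL_left M hX hZ, transpose_mul, transpose_crossCov]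

lemma crossCov_sum_right {ι : Type*} [Fintype ι] {X : ι → Ω → Vec a} {Z : Ω → Vec b}
    (hX : ∀ i, MemLp (X i) 2 μ) (hZ : MemLp Z 2 μ) :
    crossCov μ Z (fun ω => ∑ i, X i ω) = ∑ i, crossCov μ Z (X i) := by
  ext i j
  simp only [crossCov, Matrix.of_apply, Matrix.sum_apply, WithLp.ofLp_sum, Finset.sum_apply]
  exact covariance_fun_sum_right (fun l => memLp_coord (hX l) j) (memLp_coord hZ i)

lemma covariance_inner_inner {X : Ω → Vec a} {Y : Ω → Vec b} (hX : MemLp X 2 μ) (hY : MemLp Y 2 μ)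
    (u : Vec a) (v : Vec b) :
    cov[fun ω => inner ℝ u (X ω), fun ω => inner ℝ v (Y ω); μ] =
      u.ofLp ⬝ᵥ (crossCov μ X Y *ᵥ v.ofLp) := by
  simp only [inner_eq_dotProduct, dotProduct, mulVec]
  rw [covariance_fun_sum_fun_sum (fun i => (memLp_coord hX i).const_mul _)
    (fun i => (memLp_coord hY i).const_mul _)]
  simp only [covariance_const_mul_left, covariance_const_mul_right, crossCov, Matrix.of_apply,
    Finset.mul_sum]
  refine Finset.sum_congr rfl fun i _ => Finset.sum_congr rfl fun j _ => by ring

end CrossCov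

/-! ### Conditional expectations of square-integrable random vectors -/

section CondExp

variable {a b t r : ℕ} {Ω : Type*} {m mΩ : MeasurableSpace Ω} {μ : Measure Ω}

lemma integrable_inner {X Z : Ω → Vec a} (hX : MemLp X 2 μ) (hZ : MemLp Z 2 μ) :
    Integrable (fun ω => inner ℝ (X ω) (Z ω)) μ := by
  simp only [inner_eq_dotProduct, dotProduct]
  exact integrable_finsetSum _ fun i _ => (memLp_coord hX i).integrable_mul (memLp_coord hZ i)

lemma condExp_mulVecL (M : Matrix (Fin a) (Fin b) ℝ) {X : Ω → Vec b} (hX : Integrable X μ) :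
    μ[fun ω => mulVecL M (X ω) | m] =ᵐ[μ] fun ω => mulVecL M (μ[X | m] ω) :=
  ((mulVecL M).comp_condExp_comm hX).symm

lemma lintegral_norm_sq {W : Ω → Vec a} (hW : MemLp W 2 μ) :
    ∫⁻ ω, ENNReal.ofReal (‖W ω‖ ^ 2) ∂μ = ENNReal.ofReal (∫ ω, ‖W ω‖ ^ 2 ∂μ) :=
  (ofReal_integral_eq_lintegral_ofReal ((memLp_two_iff_integrable_sq_norm hW.1).1 hW)
    (.of_forall fun _ => sq_nonneg _)).symm

lemma memLp_two_of_lintegral_ne_top {W : Ω → Vec a} (hW : AEStronglyMeasurable W μ)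
    (h : ∫⁻ ω, ENNReal.ofReal (‖W ω‖ ^ 2) ∂μ ≠ ⊤) : MemLp W 2 μ := by
  rw [memLp_two_iff_integrable_sq_norm hW]
  refine ⟨(hW.norm.pow 2), ?_⟩
  rw [hasFiniteIntegral_iff_ofReal (.of_forall fun _ => sq_nonneg _)]
  exact h.lt_top

/-- Pythagoras: if `W` is orthogonal to `Z` in `L²`, then `E‖W + Z‖² = E‖W‖² + E‖Z‖²`. -/
lemma integral_norm_add_sq {W Z : Ω → Vec a} (hW : MemLp W 2 μ) (hZ : MemLp Z 2 μ)
    (h : ∫ ω, inner ℝ (W ω) (Z ω) ∂μ = 0) :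
    ∫ ω, ‖W ω + Z ω‖ ^ 2 ∂μ = ∫ ω, ‖W ω‖ ^ 2 ∂μ + ∫ ω, ‖Z ω‖ ^ 2 ∂μ := by
  have hW2 := (memLp_two_iff_integrable_sq_norm hW.1).1 hW
  have hZ2 := (memLp_two_iff_integrable_sq_norm hZ.1).1 hZ
  simp only [norm_add_sq_real]
  have hi : Integrable (fun ω => ‖W ω‖ ^ 2 + 2 * inner ℝ (W ω) (Z ω)) μ :=
    hW2.add ((integrable_inner hW hZ).const_mul 2)
  rw [integral_add hi hZ2,
    integral_add hW2 ((integrable_inner hW hZ).const_mul 2), integral_const_mul, h, mul_zero,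
    add_zero]

variable [IsProbabilityMeasure μ]

/-- The conditional expectation is the orthogonal projection onto the square-integrable
`m`-measurable random vectors. -/
lemma integral_inner_condExp (hm : m ≤ mΩ) {X Z : Ω → Vec a} (hX : MemLp X 2 μ) (hZ : MemLp Z 2 μ)
    (hZm : AEStronglyMeasurable[m] Z μ) :
    ∫ ω, inner ℝ (X ω) (Z ω) ∂μ = ∫ ω, inner ℝ (μ[X | m] ω) (Z ω) ∂μ := by
  rw [← integral_condExp hm]
  exact integral_congr_ae (condExp_bilin_of_aestronglyMeasurable_right (innerSL ℝ) hZm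
    (integrable_inner hX hZ) (hX.integrable one_le_two))

lemma crossCov_self_posSemidef {X : Ω → Vec a} (hX : MemLp X 2 μ) :
    (crossCov μ X X).PosSemidef := by
  refine .of_dotProduct_mulVec_nonneg (transpose_crossCov X X) fun u => ?_
  have := covariance_inner_inner hX hX (WithLp.toLp 2 u) (WithLp.toLp 2 u)
  simp only [star_trivial]
  have hL : MemLp (fun ω => inner ℝ (WithLp.toLp 2 u : Vec a) (X ω)) 2 μ :=
    (innerSL ℝ (WithLp.toLp 2 u : Vec a)).comp_memLp' hX
  rw [← this, covariance_self hL.aestronglyMeasurable.aemeasurable]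
  exact variance_nonneg _ _

/-- Conditioning does not increase the covariance matrix. -/
lemma crossCov_sub_condExp_posSemidef (hm : m ≤ mΩ) {X : Ω → Vec a} (hX : MemLp X 2 μ) :
    (crossCov μ X X - crossCov μ (μ[X | m]) (μ[X | m])).PosSemidef := by
  refine .of_dotProduct_mulVec_nonneg ?_ fun u => ?_
  · exact ((crossCov_self_posSemidef hX).1).sub ((crossCov_self_posSemidef
      (hX.condExp one_le_two)).1)
  have h1 := covariance_inner_inner hX hX (WithLp.toLp 2 u) (WithLp.toLp 2 u)
  have h2 := covariance_inner_inner (hX.condExp one_le_two (m := m))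
    (hX.condExp one_le_two (m := m))
    (WithLp.toLp 2 u) (WithLp.toLp 2 u)
  have hL : MemLp (fun ω => inner ℝ (WithLp.toLp 2 u : Vec a) (X ω)) 2 μ :=
    (innerSL ℝ (WithLp.toLp 2 u : Vec a)).comp_memLp' hX
  have hL' : MemLp (fun ω => inner ℝ (WithLp.toLp 2 u : Vec a) (μ[X | m] ω)) 2 μ :=
    (innerSL ℝ (WithLp.toLp 2 u : Vec a)).comp_memLp' (hX.condExp one_le_two)
  have hc : (fun ω => inner ℝ (WithLp.toLp 2 u : Vec a) (μ[X | m] ω)) =ᵐ[μ]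
      μ[fun ω => inner ℝ (WithLp.toLp 2 u : Vec a) (X ω) | m] :=
    (innerSL ℝ (WithLp.toLp 2 u : Vec a)).comp_condExp_comm (hX.integrable one_le_two)
  rw [covariance_self hL.aestronglyMeasurable.aemeasurable] at h1
  rw [covariance_self hL'.aestronglyMeasurable.aemeasurable, variance_congr hc] at h2
  simp only [star_trivial, sub_mulVec, dotProduct_sub]
  rw [← h1, ← h2, ← integral_condVar_add_variance_condExp hm hL, add_sub_cancel_right]
  refine integral_nonneg_of_ae ?_
  exact condExp_nonneg (.of_forall fun ω => sq_nonneg _)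

/-- The matrix `-(R'R)⁻¹R'Q` that maps an estimate of `x` to the minimizer of `‖Q x + R u‖²`. -/
noncomputable def lsGain (Q : Matrix (Fin r) (Fin a) ℝ) (R : Matrix (Fin r) (Fin t) ℝ) :
    Matrix (Fin t) (Fin a) ℝ :=
  -((Rᵀ * R)⁻¹ * Rᵀ * Q)

lemma transpose_mul_lsGain {Q : Matrix (Fin r) (Fin a) ℝ} {R : Matrix (Fin r) (Fin t) ℝ}
    (hR : (Rᵀ * R).PosDef) : Rᵀ * (R * lsGain Q R) = -(Rᵀ * Q) := by
  have hu := (Matrix.isUnit_iff_isUnit_det _).1 hR.isUnit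
  rw [lsGain, Matrix.mul_neg, Matrix.mul_neg, ← Matrix.mul_assoc, Matrix.mul_assoc (Rᵀ * R)⁻¹,
    Matrix.mul_nonsing_inv_cancel_left _ _ hu]

lemma mulVecL_left_inverse {R : Matrix (Fin r) (Fin t) ℝ} (hR : (Rᵀ * R).PosDef) (v : Vec t) :
    mulVecL ((Rᵀ * R)⁻¹ * Rᵀ) (mulVecL R v) = v := by
  have hu := (Matrix.isUnit_iff_isUnit_det _).1 hR.isUnit
  rw [← mulVecL_mul, Matrix.mul_assoc, Matrix.nonsing_inv_mul _ hu, mulVecL_one]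

/-- The expected quadratic cost of an `m`-measurable action exceeds that of the least-squares
action for the estimate `μ[X | m]` by the mean square of `R` times the difference of the two. -/
lemma integral_cost_eq (hm : m ≤ mΩ) (Q : Matrix (Fin r) (Fin a) ℝ) {R : Matrix (Fin r) (Fin t) ℝ}
    (hR : (Rᵀ * R).PosDef) {X : Ω → Vec a} (hX : MemLp X 2 μ) {u : Ω → Vec t} (hu : MemLp u 2 μ)
    (hum : AEStronglyMeasurable[m] u μ) :
    ∫ ω, ‖mulVecL Q (X ω) + mulVecL R (u ω)‖ ^ 2 ∂μ =
      ∫ ω, ‖mulVecL Q (X ω) + mulVecL R (mulVecL (lsGain Q R) (μ[X | m] ω))‖ ^ 2 ∂μ +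
      ∫ ω, ‖mulVecL R (u ω - mulVecL (lsGain Q R) (μ[X | m] ω))‖ ^ 2 ∂μ := by
  have hX' : MemLp (μ[X | m]) 2 μ := hX.condExp one_le_two
  have ho := memLp_mulVecL (lsGain Q R) hX'
  have hom : AEStronglyMeasurable[m] (fun ω => mulVecL (lsGain Q R) (μ[X | m] ω)) μ :=
    ((mulVecL (lsGain Q R)).continuous.comp_stronglyMeasurable
      stronglyMeasurable_condExp).aestronglyMeasurable
  have hd : MemLp (fun ω => u ω - mulVecL (lsGain Q R) (μ[X | m] ω)) 2 μ := hu.sub ho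
  have hdm : AEStronglyMeasurable[m] (fun ω => u ω - mulVecL (lsGain Q R) (μ[X | m] ω)) μ :=
    hum.sub hom
  have hc : MemLp (fun ω => mulVecL Q (X ω) + mulVecL R (mulVecL (lsGain Q R) (μ[X | m] ω))) 2 μ :=
    (memLp_mulVecL Q hX).add (memLp_mulVecL R ho)
  rw [← integral_norm_add_sq hc (memLp_mulVecL R hd)]
  · refine integral_congr_ae (.of_forall fun ω => ?_)
    simp
  -- The residual `R'(Q X + R u)` of the least-squares action is `R'Q (X - μ[X | m])`.
  have key : ∀ ω, inner ℝ (mulVecL Q (X ω) + mulVecL R (mulVecL (lsGain Q R) (μ[X | m] ω)))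
      (mulVecL R (u ω - mulVecL (lsGain Q R) (μ[X | m] ω))) =
      inner ℝ (X ω) (mulVecL (Qᵀ * R) (u ω - mulVecL (lsGain Q R) (μ[X | m] ω))) -
      inner ℝ (μ[X | m] ω) (mulVecL (Qᵀ * R) (u ω - mulVecL (lsGain Q R) (μ[X | m] ω))) := by
    intro ω
    set d := u ω - mulVecL (lsGain Q R) (μ[X | m] ω)
    have e : (R * lsGain Q R)ᵀ * R = -(Qᵀ * R) := by
      have := congrArg transpose (transpose_mul_lsGain (Q := Q) hR)
      simpa [transpose_mul, Matrix.mul_assoc] using this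
    rw [inner_add_left, inner_mulVecL_left, ← mulVecL_mul, ← mulVecL_mul, inner_mulVecL_left,
      ← mulVecL_mul, e, mulVecL_neg, inner_neg_right, ← sub_eq_add_neg]
  simp only [key]
  have hB := memLp_mulVecL (Qᵀ * R) hd
  have hBm : AEStronglyMeasurable[m]
      (fun ω => mulVecL (Qᵀ * R) (u ω - mulVecL (lsGain Q R) (μ[X | m] ω))) μ :=
    (mulVecL (Qᵀ * R)).continuous.comp_aestronglyMeasurable hdm
  rw [integral_sub (integrable_inner hX hB) (integrable_inner hX' hB), sub_eq_zero]
  exact integral_inner_condExp hm hX hB hBm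

/-- The least-squares action for the estimate `μ[X | m]` has finite cost, and it is the almost
surely unique action of least expected cost among the `m`-measurable ones. -/
lemma lintegral_cost_isLeast (hm : m ≤ mΩ) (Q : Matrix (Fin r) (Fin a) ℝ)
    {R : Matrix (Fin r) (Fin t) ℝ} (hR : (Rᵀ * R).PosDef) {X : Ω → Vec a} (hX : MemLp X 2 μ) :
    ∫⁻ ω, ENNReal.ofReal
      (‖mulVecL Q (X ω) + mulVecL R (mulVecL (lsGain Q R) (μ[X | m] ω))‖ ^ 2) ∂μ ≠ ⊤ ∧
    ∀ u : Ω → Vec t, AEStronglyMeasurable[m] u μ →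
      ∫⁻ ω, ENNReal.ofReal
        (‖mulVecL Q (X ω) + mulVecL R (mulVecL (lsGain Q R) (μ[X | m] ω))‖ ^ 2) ∂μ ≤
        ∫⁻ ω, ENNReal.ofReal (‖mulVecL Q (X ω) + mulVecL R (u ω)‖ ^ 2) ∂μ ∧
      (∫⁻ ω, ENNReal.ofReal (‖mulVecL Q (X ω) + mulVecL R (u ω)‖ ^ 2) ∂μ ≤
        ∫⁻ ω, ENNReal.ofReal
          (‖mulVecL Q (X ω) + mulVecL R (mulVecL (lsGain Q R) (μ[X | m] ω))‖ ^ 2) ∂μ →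
        u =ᵐ[μ] fun ω => mulVecL (lsGain Q R) (μ[X | m] ω)) := by
  have hX' : MemLp (μ[X | m]) 2 μ := hX.condExp one_le_two
  have hc : MemLp (fun ω => mulVecL Q (X ω) + mulVecL R (mulVecL (lsGain Q R) (μ[X | m] ω))) 2 μ :=
    (memLp_mulVecL Q hX).add (memLp_mulVecL R (memLp_mulVecL (lsGain Q R) hX'))
  have hfin := lintegral_norm_sq hc
  refine ⟨hfin ▸ ENNReal.ofReal_ne_top, fun u hum => ?_⟩
  by_cases htop : ∫⁻ ω, ENNReal.ofReal (‖mulVecL Q (X ω) + mulVecL R (u ω)‖ ^ 2) ∂μ = ⊤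
  · refine ⟨htop ▸ le_top, fun h => ?_⟩
    rw [htop, hfin] at h
    exact absurd (top_le_iff.1 h) ENNReal.ofReal_ne_top
  -- An action of finite cost is square-integrable because `R` has a left inverse.
  have hcu : MemLp (fun ω => mulVecL Q (X ω) + mulVecL R (u ω)) 2 μ :=
    memLp_two_of_lintegral_ne_top ((memLp_mulVecL Q hX).1.add
      ((mulVecL R).continuous.comp_aestronglyMeasurable (hum.mono hm))) htop
  have hu : MemLp u 2 μ := by
    have := memLp_mulVecL ((Rᵀ * R)⁻¹ * Rᵀ) (hcu.sub (memLp_mulVecL Q hX))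
    simpa [mulVecL_left_inverse hR] using this
  have heq := integral_cost_eq hm Q hR hX hu hum
  have hd : MemLp (fun ω => mulVecL R (u ω - mulVecL (lsGain Q R) (μ[X | m] ω))) 2 μ :=
    memLp_mulVecL R (hu.sub (memLp_mulVecL (lsGain Q R) hX'))
  have hd0 : 0 ≤ ∫ ω, ‖mulVecL R (u ω - mulVecL (lsGain Q R) (μ[X | m] ω))‖ ^ 2 ∂μ :=
    integral_nonneg fun _ => sq_nonneg _
  rw [lintegral_norm_sq hc, lintegral_norm_sq hcu]
  refine ⟨ENNReal.ofReal_le_ofReal (by linarith), fun h => ?_⟩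
  rw [ENNReal.ofReal_le_ofReal_iff (integral_nonneg fun _ => sq_nonneg _)] at h
  have hzero : ∫ ω, ‖mulVecL R (u ω - mulVecL (lsGain Q R) (μ[X | m] ω))‖ ^ 2 ∂μ = 0 := by
    linarith
  rw [integral_eq_zero_iff_of_nonneg (fun _ => sq_nonneg _)
    ((memLp_two_iff_integrable_sq_norm hd.1).1 hd)] at hzero
  filter_upwards [hzero] with ω hω
  have h0 : mulVecL R (u ω - mulVecL (lsGain Q R) (μ[X | m] ω)) = 0 := by simpa using hω
  have := mulVecL_left_inverse hR (u ω - mulVecL (lsGain Q R) (μ[X | m] ω))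
  rw [h0, map_zero] at this
  exact sub_eq_zero.1 this.symm

/-- The expected cost `E‖Q X + N x̂‖²` for `x̂ = μ[X | m]` exceeds the constant `E‖Q X‖²` by the
expectation of a quadratic form of `x̂`. -/
lemma integral_norm_sq_condExp (hm : m ≤ mΩ) (Q N : Matrix (Fin r) (Fin a) ℝ) {X : Ω → Vec a}
    (hX : MemLp X 2 μ) :
    ∫ ω, ‖mulVecL Q (X ω) + mulVecL N (μ[X | m] ω)‖ ^ 2 ∂μ = ∫ ω, ‖mulVecL Q (X ω)‖ ^ 2 ∂μ +
      ∫ ω, (μ[X | m] ω).ofLp ⬝ᵥ ((Nᵀ * N + Nᵀ * Q + Qᵀ * N) *ᵥ (μ[X | m] ω).ofLp) ∂μ := by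
  have hX' : MemLp (μ[X | m]) 2 μ := hX.condExp one_le_two
  have key : ∀ v : Vec a, v.ofLp ⬝ᵥ ((Nᵀ * N + Nᵀ * Q + Qᵀ * N) *ᵥ v.ofLp) =
      ‖mulVecL N v‖ ^ 2 + 2 * inner ℝ v (mulVecL (Qᵀ * N) v) := by
    intro v
    have e1 : inner ℝ v (mulVecL (Nᵀ * Q) v) = inner ℝ v (mulVecL (Qᵀ * N) v) := by
      rw [mulVecL_mul, ← inner_mulVecL_left, real_inner_comm, inner_mulVecL_left, ← mulVecL_mul]
    have e2 : inner ℝ v (mulVecL (Nᵀ * N) v) = ‖mulVecL N v‖ ^ 2 := by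
      rw [mulVecL_mul, ← inner_mulVecL_left, real_inner_self_eq_norm_sq]
    rw [two_mul]
    nth_rewrite 1 [← e1]
    rw [← e2]
    simp only [inner_eq_dotProduct, mulVecL_apply, add_mulVec, dotProduct_add]
    ring
  have hN := memLp_mulVecL N hX'
  have hQN := memLp_mulVecL (Qᵀ * N) hX'
  have hN2 := (memLp_two_iff_integrable_sq_norm hN.1).1 hN
  have hQ2 := (memLp_two_iff_integrable_sq_norm (memLp_mulVecL Q hX).1).1 (memLp_mulVecL Q hX)
  have hm' : AEStronglyMeasurable[m] (fun ω => mulVecL (Qᵀ * N) (μ[X | m] ω)) μ :=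
    ((mulVecL (Qᵀ * N)).continuous.comp_stronglyMeasurable
      stronglyMeasurable_condExp).aestronglyMeasurable
  simp only [key, norm_add_sq_real, inner_mulVecL_left, ← mulVecL_mul]
  have hi : Integrable (fun ω => ‖mulVecL Q (X ω)‖ ^ 2 +
      2 * inner ℝ (X ω) (mulVecL (Qᵀ * N) (μ[X | m] ω))) μ :=
    hQ2.add ((integrable_inner hX hQN).const_mul 2)
  rw [integral_add hN2 ((integrable_inner hX' hQN).const_mul 2), integral_add hi hN2,
    integral_add hQ2 ((integrable_inner hX hQN).const_mul 2), integral_const_mul,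
    integral_const_mul, integral_inner_condExp hm hX hQN hm']
  ring

end CondExp

/-! ### The state process -/

namespace Game.IsStateModel

variable {n p t r : ℕ} {g : Game n p t r} {Ω : Type*} [MeasurableSpace Ω] {μ : Measure Ω}
  {x : Fin (n + 1) → Ω → Vec p} {w : Fin n → Ω → Vec p}

lemma step_mulVecL (hx : g.IsStateModel μ x w) (k : Fin n) :
    x k.succ = fun ω => mulVecL g.A (x k.castSucc ω) + w k ω :=
  funext (hx.step k)

lemma measurable_state (hx : g.IsStateModel μ x w) (i : Fin (n + 1)) : Measurable (x i) := by
  induction i using Fin.induction with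
  | zero => exact hx.measurable_init
  | succ k ih =>
    rw [hx.step_mulVecL]
    exact ((mulVecL g.A).continuous.measurable.comp ih).add (hx.measurable_noise k)

/-- The states up to stage `m` are linear in the initial state and the first noise vectors. -/
lemma exists_state_eq (hx : g.IsStateModel μ x w) (m i : Fin (n + 1)) (hi : i ≤ m) :
    ∃ T : (Finset.Iic m → Vec p) →L[ℝ] Vec p,
      ∀ ω, x i ω = T fun j => (Fin.cons (α := fun _ => Ω → Vec p) (x 0) w : _) j ω := by
  induction i using Fin.induction with
  | zero => exact ⟨ContinuousLinearMap.proj ⟨0, by simp⟩, fun ω => rfl⟩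
  | succ k ih =>
    obtain ⟨T, hT⟩ := ih (k.castSucc_lt_succ.le.trans hi)
    refine ⟨(mulVecL g.A).comp T + ContinuousLinearMap.proj ⟨k.succ, by simpa using hi⟩,
      fun ω => ?_⟩
    rw [congrFun (hx.step_mulVecL k) ω, hT]
    rfl

lemma memLp_noise (hx : g.IsStateModel μ x w) (k : Fin n) : MemLp (w k) 2 μ := by
  have : IsGaussian (μ.map (w k)) := hx.law_noise k ▸ inferInstance
  exact (IsGaussian.hasGaussianLaw (X := w k)).memLp_two

lemma hasGaussianLaw_states (hx : g.IsStateModel μ x w) : HasGaussianLaw (fun ω i => x i ω) μ := by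
  have h1 : ∀ i, HasGaussianLaw ((Fin.cons (α := fun _ => Ω → Vec p) (x 0) w : _) i) μ := by
    intro i
    cases i using Fin.cases with
    | zero =>
      have : IsGaussian (μ.map (x 0)) := hx.law_init ▸ inferInstance
      exact IsGaussian.hasGaussianLaw (X := x 0)
    | succ k =>
      have : IsGaussian (μ.map (w k)) := hx.law_noise k ▸ inferInstance
      exact IsGaussian.hasGaussianLaw (X := w k)
  choose T hT using fun i => hx.exists_state_eq (Fin.last n) i (Fin.le_last i)
  have h2 := (hx.indep.hasGaussianLaw h1).map (ContinuousLinearMap.pi fun i => (T i).comp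
    (ContinuousLinearMap.pi fun j : Finset.Iic (Fin.last n) =>
      ContinuousLinearMap.proj (j : Fin (n + 1))))
  have e : (fun ω i => x i ω) = fun ω i => T i fun j : Finset.Iic (Fin.last n) =>
      (Fin.cons (α := fun _ => Ω → Vec p) (x 0) w : _) j ω := by
    funext ω i
    exact hT i ω
  rw [e]
  exact h2

lemma memLp_state (hx : g.IsStateModel μ x w) (i : Fin (n + 1)) : MemLp (x i) 2 μ :=
  (hx.hasGaussianLaw_states.eval i).memLp_two

/-- The noise vector of stage `k` is independent of the history of the states up to stage `k`. -/
lemma indepFun_history_noise (hx : g.IsStateModel μ x w) (k : Fin n) :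
    IndepFun (fun ω (i : Fin (k + 1)) => x ⟨i, by omega⟩ ω) (w k) μ := by
  have hmeas : ∀ i, Measurable ((Fin.cons (α := fun _ => Ω → Vec p) (x 0) w : _) i) := by
    intro i
    cases i using Fin.cases with
    | zero => exact hx.measurable_init
    | succ k => exact hx.measurable_noise k
  have hind := hx.indep.indepFun_finset (Finset.Iic k.castSucc) {k.succ} (by simp) hmeas
  choose T hT using fun i : Fin (k + 1) => hx.exists_state_eq k.castSucc ⟨i, by omega⟩
    (Fin.le_def.2 (Nat.lt_succ_iff.1 i.2))
  have hφ : Measurable fun (v : Finset.Iic k.castSucc → Vec p) i => T i v :=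
    measurable_pi_lambda _ fun i => (T i).continuous.measurable
  have hψ : Measurable fun v : ({k.succ} : Finset (Fin (n + 1))) → Vec p =>
      v ⟨k.succ, Finset.mem_singleton_self _⟩ := measurable_pi_apply _
  have := hind.comp hφ hψ
  have e : (fun ω (i : Fin (k + 1)) => x ⟨i, by omega⟩ ω) =
      fun ω i => T i fun j : Finset.Iic k.castSucc =>
        (Fin.cons (α := fun _ => Ω → Vec p) (x 0) w : _) j ω := by
    funext ω i
    exact hT i ω
  rw [e]
  exact this

lemma indepFun_state_noise (hx : g.IsStateModel μ x w) (k : Fin n) (i : Fin (n + 1))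
    (hi : i ≤ k.castSucc) : IndepFun (x i) (w k) μ :=
  (hx.indepFun_history_noise k).comp
    (φ := fun v : Fin (k + 1) → Vec p => v ⟨i, Nat.lt_succ_iff.2 (Fin.le_def.1 hi)⟩)
    (measurable_pi_apply (⟨i, _⟩ : Fin (k + 1))) measurable_id

lemma integral_noise (hx : g.IsStateModel μ x w) (k : Fin n) : ∫ ω, w k ω ∂μ = 0 := by
  have := integral_map (hx.measurable_noise k).aemeasurable (f := fun v : Vec p => v) (μ := μ)
    aestronglyMeasurable_id
  rw [← this, hx.law_noise, integral_id_multivariateGaussian]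

lemma crossCov_of_law {X : Ω → Vec p} (hX : Measurable X) {C : Matrix (Fin p) (Fin p) ℝ}
    (hC : C.PosSemidef) (h : μ.map X = multivariateGaussian 0 C) : crossCov μ X X = C := by
  ext i j
  have hc : ∀ i, AEStronglyMeasurable (fun v : Vec p => v i) (μ.map X) := fun i =>
    (EuclideanSpace.proj (𝕜 := ℝ) i : Vec p →L[ℝ] ℝ).continuous.aestronglyMeasurable
  have := covariance_map_fun (hc i) (hc j) hX.aemeasurable
  rw [h, covariance_eval_multivariateGaussian hC] at this
  exact this.symm

lemma crossCov_noise (hx : g.IsStateModel μ x w) (k : Fin n) :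
    crossCov μ (w k) (w k) = g.SigmaW :=
  crossCov_of_law (hx.measurable_noise k) g.posDef_SigmaW.posSemidef (hx.law_noise k)

variable [IsProbabilityMeasure μ]

lemma integral_state (hx : g.IsStateModel μ x w) (i : Fin (n + 1)) : ∫ ω, x i ω ∂μ = 0 := by
  induction i using Fin.induction with
  | zero =>
    have := integral_map hx.measurable_init.aemeasurable (f := fun v : Vec p => v) (μ := μ)
      aestronglyMeasurable_id
    rw [← this, hx.law_init, integral_id_multivariateGaussian]
  | succ k ih =>
    have h1 := (hx.memLp_state k.castSucc).integrable one_le_two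
    rw [hx.step_mulVecL, integral_add ((mulVecL g.A).integrable_comp h1)
      ((hx.memLp_noise k).integrable one_le_two), hx.integral_noise,
      ContinuousLinearMap.integral_comp_comm _ h1, ih, map_zero, add_zero]

/-- The covariance recursion for `A X + w` when `X` and `w` are uncorrelated. -/
lemma crossCov_step (hx : g.IsStateModel μ x w) (k : Fin n) {X : Ω → Vec p} (hX : MemLp X 2 μ)
    (h : crossCov μ X (w k) = 0) :
    crossCov μ (fun ω => mulVecL g.A (X ω) + w k ω) (fun ω => mulVecL g.A (X ω) + w k ω) =
      g.A * crossCov μ X X * g.Aᵀ + g.SigmaW := by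
  have hA := memLp_mulVecL g.A hX
  have hw := hx.memLp_noise k
  have h' : crossCov μ (w k) X = 0 := by rw [← transpose_crossCov, h, transpose_zero]
  have hs : MemLp (fun ω => mulVecL g.A (X ω) + w k ω) 2 μ := hA.add hw
  rw [crossCov_add_left hA hw hs, crossCov_add_right hA hw hA,
    crossCov_add_right hA hw hw, crossCov_mulVecL_left _ hX hA, crossCov_mulVecL_right _ hX hX,
    crossCov_mulVecL_left _ hX hw, crossCov_mulVecL_right _ hX hw, h, h', hx.crossCov_noise]
  simp [Matrix.mul_assoc]

lemma crossCov_state (hx : g.IsStateModel μ x w) (i : Fin (n + 1)) :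
    crossCov μ (x i) (x i) = g.stateCov i := by
  induction i using Fin.induction with
  | zero => exact crossCov_of_law hx.measurable_init g.posDef_Sigma1.posSemidef hx.law_init
  | succ k ih =>
    rw [hx.step_mulVecL, hx.crossCov_step k (hx.memLp_state _)
      (crossCov_eq_zero_of_indepFun (hx.memLp_state _) (hx.memLp_noise k)
        (hx.indepFun_state_noise k _ le_rfl)), ih]
    rfl

end Game.IsStateModel

/-! ### Posteriors for arbitrary sender policies -/

section Posterior


/-- The σ-algebra generated by the messages up to stage `k`. -/
abbrev messageSigma {n p : ℕ} {Ω : Type*} (x : Fin (n + 1) → Ω → Vec p) (η : SenderPolicy n p)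
    (k : Fin n) : MeasurableSpace Ω :=
  MeasurableSpace.comap (messages x η k) inferInstance

lemma messageSigma_mono {n p : ℕ} {Ω : Type*} (x : Fin (n + 1) → Ω → Vec p)
    (η : SenderPolicy n p) {j k : Fin n} (hjk : j ≤ k) :
    messageSigma x η j ≤ messageSigma x η k := by
  have : messages x η j = (fun v (i : Fin (j + 1)) => v ⟨i, by have := Fin.le_def.1 hjk; omega⟩) ∘
      messages x η k := rfl
  rw [messageSigma, this, ← MeasurableSpace.comap_comp]
  exact MeasurableSpace.comap_mono
    (measurable_pi_lambda _ fun _ => measurable_pi_apply _).comap_le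

variable {n p t r : ℕ} {g : Game n p t r} {Ω : Type*} [mΩ : MeasurableSpace Ω] {μ : Measure Ω}
  {x : Fin (n + 1) → Ω → Vec p} {w : Fin n → Ω → Vec p}

lemma measurable_messages (hx : g.IsStateModel μ x w) {η : SenderPolicy n p} (hη : η.Admissible)
    (k : Fin n) : Measurable (messages x η k) :=
  measurable_pi_lambda _ fun _ => (hη _).comp
    (measurable_pi_lambda _ fun _ => hx.measurable_state _)

lemma messageSigma_le (hx : g.IsStateModel μ x w) {η : SenderPolicy n p} (hη : η.Admissible)
    (k : Fin n) : messageSigma x η k ≤ mΩ :=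
  (measurable_messages hx hη k).comap_le

lemma memLp_posterior (hx : g.IsStateModel μ x w) (η : SenderPolicy n p) (k : Fin n) :
    MemLp (posterior μ x η k) 2 μ :=
  (hx.memLp_state _).condExp one_le_two

lemma posteriorCov_eq_crossCov (η : SenderPolicy n p) (k : Fin n) :
    posteriorCov μ x η k = crossCov μ (posterior μ x η k) (posterior μ x η k) := rfl

variable [IsProbabilityMeasure μ]

lemma integral_posterior (hx : g.IsStateModel μ x w) {η : SenderPolicy n p} (hη : η.Admissible)
    (k : Fin n) : ∫ ω, posterior μ x η k ω ∂μ = 0 := by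
  rw [posterior, integral_condExp (messageSigma_le hx hη k), hx.integral_state]

/-- The messages up to stage `k` predict the state of stage `k + 1` as `A x̂_k`. -/
lemma condExp_state_succ (hx : g.IsStateModel μ x w) {η : SenderPolicy n p} (hη : η.Admissible)
    (k : Fin n) :
    μ[x k.succ | messageSigma x η k] =ᵐ[μ] fun ω => mulVecL g.A (posterior μ x η k ω) := by
  have hle := messageSigma_le hx hη k
  have hi := (hx.memLp_state k.castSucc).integrable one_le_two
  have hind : IndepFun (w k) (messages x η k) μ := by
    have := (hx.indepFun_history_noise k).symm.comp (φ := id)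
      (ψ := fun (v : Fin (k + 1) → Vec p) (i : Fin (k + 1)) => η ⟨i, by omega⟩
        fun l => v ⟨l, lt_of_lt_of_le l.2 i.2⟩)
      measurable_id (measurable_pi_lambda _ fun i => (hη ⟨i, by omega⟩).comp
        (measurable_pi_lambda _ fun l => measurable_pi_apply (⟨l, _⟩ : Fin (k + 1))))
    exact this
  have hw : μ[w k | messageSigma x η k] =ᵐ[μ] fun _ => 0 := by
    have := condExp_indep_eq (hx.measurable_noise k).comap_le hle
      (comap_measurable (w k)).stronglyMeasurable hind
    rwa [hx.integral_noise] at this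
  rw [hx.step_mulVecL]
  filter_upwards [condExp_add (m := messageSigma x η k) ((mulVecL g.A).integrable_comp hi)
    ((hx.memLp_noise k).integrable one_le_two), hw,
    condExp_mulVecL (m := messageSigma x η k) g.A hi] with ω e1 e2 e3
  refine e1.trans ?_
  rw [Pi.add_apply, e2, add_zero]
  exact e3

/-- The posterior covariances of every sender policy are feasible for the semidefinite program. -/
lemma posteriorCov_mem_sdpFeasible (hx : g.IsStateModel μ x w) {η : SenderPolicy n p}
    (hη : η.Admissible) : posteriorCov μ x η ∈ g.sdpFeasible := by
  intro k
  refine ⟨transpose_crossCov _ _, ?_, ?_⟩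
  · have := crossCov_sub_condExp_posSemidef (messageSigma_le hx hη k) (hx.memLp_state k.castSucc)
    rwa [hx.crossCov_state] at this
  obtain ⟨_ | j, hk⟩ := k
  · simpa [prev, posteriorCov_eq_crossCov] using
      crossCov_self_posSemidef (memLp_posterior hx η ⟨0, hk⟩)
  have hj : j < n := by omega
  have hpost := memLp_posterior hx η ⟨j + 1, hk⟩
  have hprev := memLp_posterior hx η ⟨j, hj⟩
  have hle : (⟨j, hj⟩ : Fin n) ≤ ⟨j + 1, hk⟩ := Fin.le_def.2 (Nat.le_succ j)
  have hpsd := crossCov_sub_condExp_posSemidef (messageSigma_le hx hη ⟨j, hj⟩) hpost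
  -- By the tower property, the posterior of the later stage is predicted as `A x̂_j` as well.
  have htower : μ[posterior μ x η ⟨j + 1, hk⟩ | messageSigma x η ⟨j, hj⟩] =ᵐ[μ]
      fun ω => mulVecL g.A (posterior μ x η ⟨j, hj⟩ ω) :=
    (condExp_condExp_of_le (messageSigma_mono x η hle) (messageSigma_le hx hη _)).trans
      (condExp_state_succ hx hη ⟨j, hj⟩)
  rw [crossCov_congr htower htower, crossCov_mulVecL_left _ hprev (memLp_mulVecL _ hprev),
    crossCov_mulVecL_right _ hprev hprev, ← Matrix.mul_assoc] at hpsd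
  simpa [prev, posteriorCov_eq_crossCov] using hpsd

/-- The sender's reduced objective is the objective of the semidefinite program at the posterior
covariances. -/
lemma posteriorObjective_eq (hx : g.IsStateModel μ x w) {η : SenderPolicy n p}
    (hη : η.Admissible) :
    g.posteriorObjective μ x η = g.sdpObjective (posteriorCov μ x η) :=
  Finset.sum_congr rfl fun k _ => integral_dotProduct_mulVec (memLp_posterior hx η k)
    (integral_posterior hx hη k) (g.V k)

end Posterior

/-! ### The filter gain -/

section FilterGain

variable {p : ℕ} {G U D : Matrix (Fin p) (Fin p) ℝ}

open scoped MatrixOrder in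
lemma msqrt_mul_self (hG : G.PosSemidef) : msqrt G * msqrt G = G :=
  CFC.sqrt_mul_sqrt_self G hG.nonneg

open scoped MatrixOrder in
lemma transpose_msqrt (G : Matrix (Fin p) (Fin p) ℝ) : (msqrt G)ᵀ = msqrt G :=
  (Matrix.nonneg_iff_posSemidef.1 (CFC.sqrt_nonneg G)).1

lemma isUnit_det_msqrt (hG : G.PosDef) : IsUnit (msqrt G).det := by
  have h := (Matrix.isUnit_iff_isUnit_det _).1 hG.isUnit
  rw [← msqrt_mul_self hG.posSemidef, det_mul] at h
  exact isUnit_of_mul_isUnit_left h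

/-- The error matrix `1 - G^{1/2} U L'` of the measurement update with `L = G^{-1/2} U D` is
conjugate to the complementary projection `1 - U D U'`. -/
lemma one_sub_gain_eq (hG : G.PosDef) (hP : (U * D * Uᵀ).IsSymm) :
    1 - msqrt G * U * ((msqrt G)⁻¹ * U * D)ᵀ =
      msqrt G * (1 - U * D * Uᵀ) * (msqrt G)⁻¹ := by
  have hu := isUnit_det_msqrt hG
  have hP' : U * (Dᵀ * Uᵀ) = U * D * Uᵀ := by
    have := hP.eq
    rwa [transpose_mul, transpose_mul, transpose_transpose] at this
  rw [transpose_mul, transpose_mul, transpose_nonsing_inv, transpose_msqrt, Matrix.mul_sub,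
    Matrix.sub_mul, Matrix.mul_one, Matrix.mul_nonsing_inv _ hu, ← hP']
  simp only [Matrix.mul_assoc]

/-- The updated error is uncorrelated with the new message. -/
lemma one_sub_gain_mul (hG : G.PosDef) (hP : (U * D * Uᵀ).IsSymm)
    (hI : IsIdempotentElem (U * D * Uᵀ)) (hU : Uᵀ * U = 1) :
    (1 - msqrt G * U * ((msqrt G)⁻¹ * U * D)ᵀ) * G * ((msqrt G)⁻¹ * U * D) = 0 := by
  have hu := isUnit_det_msqrt hG
  have hUD : U * D = U * D * Uᵀ * U := by rw [Matrix.mul_assoc _ Uᵀ, hU, Matrix.mul_one]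
  have h0 : (1 - U * D * Uᵀ) * (U * D) = 0 := by
    calc _ = (1 - U * D * Uᵀ) * (U * D * Uᵀ * U) := by rw [← hUD]
      _ = (1 - U * D * Uᵀ) * (U * D * Uᵀ) * U := (Matrix.mul_assoc _ _ _).symm
      _ = 0 := by rw [Matrix.sub_mul, Matrix.one_mul, hI.eq, sub_self, Matrix.zero_mul]
  rw [one_sub_gain_eq hG hP]
  nth_rewrite 3 [← msqrt_mul_self hG.posSemidef]
  calc _ = msqrt G * (1 - U * D * Uᵀ) * ((msqrt G)⁻¹ * msqrt G) * (msqrt G * (msqrt G)⁻¹) *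
        (U * D) := by simp only [Matrix.mul_assoc]
    _ = msqrt G * ((1 - U * D * Uᵀ) * (U * D)) := by
      rw [Matrix.nonsing_inv_mul _ hu, Matrix.mul_nonsing_inv _ hu, Matrix.mul_one, Matrix.mul_one,
        Matrix.mul_assoc]
    _ = 0 := by rw [h0, Matrix.mul_zero]

/-- The covariance matrix of the updated error. -/
lemma one_sub_gain_conj (hG : G.PosDef) (hP : (U * D * Uᵀ).IsSymm)
    (hI : IsIdempotentElem (U * D * Uᵀ)) :
    (1 - msqrt G * U * ((msqrt G)⁻¹ * U * D)ᵀ) * G *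
      (1 - msqrt G * U * ((msqrt G)⁻¹ * U * D)ᵀ)ᵀ = G - msqrt G * (U * D * Uᵀ) * msqrt G := by
  have hu := isUnit_det_msqrt hG
  have hsq := msqrt_mul_self hG.posSemidef
  rw [one_sub_gain_eq hG hP]
  set P := U * D * Uᵀ
  have hQ : (1 - P) * (1 - P) = 1 - P := hI.one_sub.eq
  rw [transpose_mul, transpose_mul, transpose_sub, transpose_one, hP.eq, transpose_nonsing_inv,
    transpose_msqrt]
  nth_rewrite 3 [← hsq]
  calc _ = msqrt G * (1 - P) * ((msqrt G)⁻¹ * msqrt G) * (msqrt G * (msqrt G)⁻¹) *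
        ((1 - P) * msqrt G) := by simp only [Matrix.mul_assoc]
    _ = msqrt G * ((1 - P) * (1 - P)) * msqrt G := by
      rw [Matrix.nonsing_inv_mul _ hu, Matrix.mul_nonsing_inv _ hu, Matrix.mul_one, Matrix.mul_one]
      simp only [Matrix.mul_assoc]
    _ = G - msqrt G * P * msqrt G := by
      rw [hQ, Matrix.mul_sub, Matrix.sub_mul, Matrix.mul_one, hsq]

end FilterGain

lemma gap_succ {n p t r : ℕ} (g : Game n p t r) (S : Fin n → Matrix (Fin p) (Fin p) ℝ) {j : ℕ}
    (hj : j + 1 < n) :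
    g.gap S ⟨j + 1, hj⟩ = g.A * (g.stateCov j - S ⟨j, by omega⟩) * g.Aᵀ + g.SigmaW := by
  simp only [Game.gap, prev, Game.stateCov, Matrix.mul_sub, Matrix.sub_mul, Nat.add_eq_zero_iff,
    one_ne_zero, and_false, if_false, Nat.add_sub_cancel]
  abel

/-- The covariance of the prediction error is positive definite at every feasible point. -/
lemma posDef_gap {n p t r : ℕ} {g : Game n p t r} {S : Fin n → Matrix (Fin p) (Fin p) ℝ}
    (hS : S ∈ g.sdpFeasible) (k : Fin n) : (g.gap S k).PosDef := by
  obtain ⟨_ | j, hk⟩ := k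
  · simpa [Game.gap, prev, Game.stateCov] using g.posDef_Sigma1
  have hj : j < n := by omega
  have h1 := (hS ⟨j, hj⟩).2.1.mul_mul_conjTranspose_same g.A
  have h2 := Matrix.PosDef.posSemidef_add h1 g.posDef_SigmaW
  rw [conjTranspose_eq_transpose_of_trivial] at h2
  rwa [gap_succ]

/-! ### Linear estimates -/

section LinearEstimate

variable {p m : ℕ} {Ω : Type*} [MeasurableSpace Ω] {μ : Measure Ω}

/-- `X` has a linear estimate from the random vectors `Y_i` whose error is uncorrelated with every
`Y_i` and has covariance matrix `M`. -/
def HasLinearEstimate (μ : Measure Ω) (X : Ω → Vec p) (Y : Fin m → Ω → Vec p)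
    (M : Matrix (Fin p) (Fin p) ℝ) : Prop :=
  ∃ B : Fin m → Matrix (Fin p) (Fin p) ℝ,
    crossCov μ (fun ω => X ω - ∑ i, mulVecL (B i) (Y i ω))
      (fun ω => X ω - ∑ i, mulVecL (B i) (Y i ω)) = M ∧
    ∀ i, crossCov μ (fun ω => X ω - ∑ i, mulVecL (B i) (Y i ω)) (Y i) = 0

lemma memLp_sum_mulVecL {Y : Fin m → Ω → Vec p} (hY : ∀ i, MemLp (Y i) 2 μ)
    (B : Fin m → Matrix (Fin p) (Fin p) ℝ) : MemLp (fun ω => ∑ i, mulVecL (B i) (Y i ω)) 2 μ :=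
  memLp_finsetSum _ fun i _ => memLp_mulVecL (B i) (hY i)

variable [IsFiniteMeasure μ]

lemma crossCov_sum_mulVecL_eq_zero {E : Ω → Vec p} (hE : MemLp E 2 μ) {Y : Fin m → Ω → Vec p}
    (hY : ∀ i, MemLp (Y i) 2 μ) (h : ∀ i, crossCov μ E (Y i) = 0)
    (B : Fin m → Matrix (Fin p) (Fin p) ℝ) :
    crossCov μ E (fun ω => ∑ i, mulVecL (B i) (Y i ω)) = 0 := by
  rw [crossCov_sum_right (fun i => memLp_mulVecL (B i) (hY i)) hE]
  refine Finset.sum_eq_zero fun i _ => ?_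
  rw [crossCov_mulVecL_right _ (hY i) hE, h, Matrix.zero_mul]

/-- Measurement update: an additional message `L' X` with `L = G^{-1/2} U D` reduces the error
covariance from `G` to `G - G^{1/2} (U D U') G^{1/2}`. -/
lemma HasLinearEstimate.update {X : Ω → Vec p} (hX : MemLp X 2 μ) {Y : Fin (m + 1) → Ω → Vec p}
    (hY : ∀ i, MemLp (Y i) 2 μ) {G U D : Matrix (Fin p) (Fin p) ℝ} (hG : G.PosDef)
    (hP : (U * D * Uᵀ).IsSymm) (hI : IsIdempotentElem (U * D * Uᵀ)) (hU : Uᵀ * U = 1)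
    (hlast : Y (Fin.last m) = fun ω => mulVecL ((msqrt G)⁻¹ * U * D)ᵀ (X ω))
    (h : HasLinearEstimate μ X (fun i : Fin m => Y i.castSucc) G) :
    HasLinearEstimate μ X Y (G - msqrt G * (U * D * Uᵀ) * msqrt G) := by
  obtain ⟨C, hC, hCY⟩ := h
  set L := (msqrt G)⁻¹ * U * D with hL
  set K := msqrt G * U with hK
  set z : Ω → Vec p := fun ω => ∑ i : Fin m, mulVecL (C i) (Y i.castSucc ω) with hz
  have hzL : MemLp z 2 μ := memLp_sum_mulVecL (fun i : Fin m => hY i.castSucc) C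
  have he : MemLp (fun ω => X ω - z ω) 2 μ := hX.sub hzL
  -- The new estimate is `z + K (L' X - L' z)`.
  refine ⟨Fin.lastCases K fun i => (1 - K * Lᵀ) * C i, ?_⟩
  have hE : (fun ω => X ω - ∑ i, mulVecL ((Fin.lastCases K fun i => (1 - K * Lᵀ) * C i :
      (i : Fin (m + 1)) → Matrix (Fin p) (Fin p) ℝ) i) (Y i ω)) =
      fun ω => mulVecL (1 - K * Lᵀ) (X ω - z ω) := by
    funext ω
    rw [Fin.sum_univ_castSucc]
    simp only [Fin.lastCases_castSucc, Fin.lastCases_last, hlast, mulVecL_mul]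
    rw [← map_sum]
    simp only [map_sub, mulVecL_sub, mulVecL_one, mulVecL_mul, hz]
    abel
  rw [hE]
  have hE2 := memLp_mulVecL (1 - K * Lᵀ) he
  refine ⟨?_, fun i => ?_⟩
  · rw [crossCov_mulVecL_left _ he hE2, crossCov_mulVecL_right _ he he, hC, ← Matrix.mul_assoc]
    exact one_sub_gain_conj hG hP hI
  cases i using Fin.lastCases with
  | cast i => rw [crossCov_mulVecL_left _ he (hY _), hCY, Matrix.mul_zero]
  | last =>
    -- The new message is `L' (X - z) + L' z`, and the error is uncorrelated with both parts.
    have hsplit : Y (Fin.last m) = fun ω => mulVecL Lᵀ (X ω - z ω) + mulVecL Lᵀ (z ω) := by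
      rw [hlast]
      funext ω
      rw [← map_add, sub_add_cancel]
    rw [hsplit, crossCov_add_right (memLp_mulVecL _ he) (memLp_mulVecL _ hzL) hE2,
      crossCov_mulVecL_left _ he (memLp_mulVecL _ he), crossCov_mulVecL_right _ he he, hC,
      crossCov_mulVecL_left _ he (memLp_mulVecL _ hzL), crossCov_mulVecL_right _ hzL he,
      crossCov_sum_mulVecL_eq_zero he (fun i : Fin m => hY i.castSucc) hCY C, Matrix.zero_mul,
      Matrix.mul_zero, add_zero, transpose_transpose, ← Matrix.mul_assoc]
    exact one_sub_gain_mul hG hP hI hU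

end LinearEstimate

/-- Time update: the linear estimate of the next state from the same messages. -/
lemma HasLinearEstimate.predict {n p t r m : ℕ} {g : Game n p t r} {Ω : Type*}
    [MeasurableSpace Ω] {μ : Measure Ω} [IsProbabilityMeasure μ] {x : Fin (n + 1) → Ω → Vec p}
    {w : Fin n → Ω → Vec p} (hx : g.IsStateModel μ x w) (k : Fin n) {Y : Fin m → Ω → Vec p}
    (hY : ∀ i, MemLp (Y i) 2 μ) (hYw : ∀ i, crossCov μ (w k) (Y i) = 0)
    {M : Matrix (Fin p) (Fin p) ℝ} (h : HasLinearEstimate μ (x k.castSucc) Y M) :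
    HasLinearEstimate μ (x k.succ) Y (g.A * M * g.Aᵀ + g.SigmaW) := by
  obtain ⟨B, hB, hBY⟩ := h
  have hX := hx.memLp_state k.castSucc
  have hw := hx.memLp_noise k
  have hz := memLp_sum_mulVecL hY B
  set z : Ω → Vec p := fun ω => ∑ i, mulVecL (B i) (Y i ω) with hz_def
  have he : MemLp (fun ω => x k.castSucc ω - z ω) 2 μ := hX.sub hz
  refine ⟨fun i => g.A * B i, ?_⟩
  have hE : (fun ω => x k.succ ω - ∑ i, mulVecL (g.A * B i) (Y i ω)) =
      fun ω => mulVecL g.A (x k.castSucc ω - z ω) + w k ω := by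
    funext ω
    simp only [mulVecL_mul, ← map_sum, map_sub, congrFun (hx.step_mulVecL k) ω, hz_def]
    abel
  rw [hE]
  refine ⟨?_, fun i => ?_⟩
  · rw [hx.crossCov_step k he, hB]
    have e : (fun ω => x k.castSucc ω - z ω) =
        fun ω => x k.castSucc ω + mulVecL (-1) (z ω) := by
      funext ω
      rw [mulVecL_neg, mulVecL_one, sub_eq_add_neg]
    rw [← transpose_crossCov, e, crossCov_add_right hX (memLp_mulVecL _ hz) hw,
      crossCov_mulVecL_right _ hz hw, crossCov_sum_mulVecL_eq_zero hw hY hYw, ← transpose_crossCov,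
      crossCov_eq_zero_of_indepFun hX hw (hx.indepFun_state_noise k _ le_rfl)]
    simp
  · rw [crossCov_add_left (memLp_mulVecL _ he) hw (hY i), crossCov_mulVecL_left _ he (hY i), hBY,
      hYw, Matrix.mul_zero, add_zero]

/-! ### Posteriors for the optimal linear policy -/

section Optimal

lemma message_memorylessLinear {n p : ℕ} {Ω : Type*} (x : Fin (n + 1) → Ω → Vec p)
    (L : Fin n → Matrix (Fin p) (Fin p) ℝ) (k : Fin n) :
    message x (memorylessLinear L) k = fun ω => mulVecL (L k)ᵀ (x k.castSucc ω) := rfl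

variable {n p t r : ℕ} {g : Game n p t r} {Ω : Type*} [MeasurableSpace Ω] {μ : Measure Ω}
  {x : Fin (n + 1) → Ω → Vec p} {w : Fin n → Ω → Vec p}

lemma admissible_memorylessLinear (L : Fin n → Matrix (Fin p) (Fin p) ℝ) :
    (memorylessLinear L).Admissible := fun k =>
  (mulVecL (L k)ᵀ).continuous.measurable.comp (measurable_pi_apply (Fin.last (k : ℕ)))

lemma memLp_message (hx : g.IsStateModel μ x w) (L : Fin n → Matrix (Fin p) (Fin p) ℝ)
    (k : Fin n) : MemLp (message x (memorylessLinear L) k) 2 μ :=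
  memLp_mulVecL _ (hx.memLp_state _)

variable [IsProbabilityMeasure μ]

/-- The linear filter of the policy `memorylessLinear L` has error covariance `Σ_k - S_k`. -/
lemma hasLinearEstimate_messages (hx : g.IsStateModel μ x w)
    {S U D L : Fin n → Matrix (Fin p) (Fin p) ℝ} (hS : S ∈ g.sdpFeasible)
    (hP : ∀ k, (U k * D k * (U k)ᵀ).IsSymm) (hI : ∀ k, IsIdempotentElem (U k * D k * (U k)ᵀ))
    (hU : ∀ k, (U k)ᵀ * U k = 1)
    (hSP : ∀ k, S k = g.A * prev S k * g.Aᵀ +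
      msqrt (g.gap S k) * (U k * D k * (U k)ᵀ) * msqrt (g.gap S k))
    (hL : ∀ k, L k = (msqrt (g.gap S k))⁻¹ * U k * D k) (m : ℕ) (hm : m < n) :
    HasLinearEstimate μ (x (⟨m, hm⟩ : Fin n).castSucc)
      (fun i : Fin (m + 1) => message x (memorylessLinear L) ⟨i, by omega⟩)
      (g.stateCov m - S ⟨m, hm⟩) := by
  have hY := memLp_message hx L
  have hupd : HasLinearEstimate μ (x (⟨m, hm⟩ : Fin n).castSucc)
      (fun i : Fin m => message x (memorylessLinear L) ⟨i, by omega⟩) (g.gap S ⟨m, hm⟩) →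
      HasLinearEstimate μ (x (⟨m, hm⟩ : Fin n).castSucc)
      (fun i : Fin (m + 1) => message x (memorylessLinear L) ⟨i, by omega⟩)
      (g.stateCov m - S ⟨m, hm⟩) := by
    intro h
    have := HasLinearEstimate.update (hx.memLp_state _)
      (Y := fun i : Fin (m + 1) => message x (memorylessLinear L) ⟨i, by omega⟩)
      (fun i => hY _) (posDef_gap hS ⟨m, hm⟩) (hP ⟨m, hm⟩) (hI ⟨m, hm⟩) (hU ⟨m, hm⟩)
      (by rw [← hL]; exact message_memorylessLinear x L ⟨m, hm⟩) h
    convert this using 1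
    rw [hSP ⟨m, hm⟩]
    nth_rewrite 3 [Game.gap]
    abel
  refine hupd ?_
  cases m with
  | zero =>
    refine ⟨Fin.elim0, ?_, fun i => i.elim0⟩
    simpa [Game.gap, prev] using hx.crossCov_state (0 : Fin (n + 1))
  | succ m =>
    have hm' : m < n := by omega
    have ih := hasLinearEstimate_messages hx hS hP hI hU hSP hL m hm'
    have := ih.predict hx ⟨m, hm'⟩ (fun i => hY _) fun i => by
      rw [message_memorylessLinear, crossCov_mulVecL_right _ (hx.memLp_state _)
        (hx.memLp_noise _), ← transpose_crossCov, crossCov_eq_zero_of_indepFun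
        (hx.memLp_state _) (hx.memLp_noise _)
        (hx.indepFun_state_noise _ _ (Fin.le_def.2 (Nat.lt_succ_iff.1 i.2)))]
      simp
    rw [gap_succ]
    exact this

/-- In the Gaussian model, a linear estimate from the messages whose error is uncorrelated with
the messages is the posterior. -/
lemma posterior_ae_eq_of_uncorrelated (hx : g.IsStateModel μ x w)
    (L : Fin n → Matrix (Fin p) (Fin p) ℝ) (k : Fin n)
    (B : Fin (k + 1) → Matrix (Fin p) (Fin p) ℝ)
    (hB : ∀ i : Fin (k + 1), crossCov μ (fun ω => x k.castSucc ω -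
      ∑ i, mulVecL (B i) (messages x (memorylessLinear L) k ω i))
      (message x (memorylessLinear L) ⟨i, by omega⟩) = 0) :
    posterior μ x (memorylessLinear L) k =ᵐ[μ]
      fun ω => ∑ i, mulVecL (B i) (messages x (memorylessLinear L) k ω i) := by
  set η := memorylessLinear L
  have hη : η.Admissible := admissible_memorylessLinear L
  have hY := memLp_message hx L
  have hYm : ∀ i : Fin (k + 1), MemLp (fun ω => messages x η k ω i) 2 μ := fun i => hY _
  have hX := hx.memLp_state k.castSucc
  set z : Ω → Vec p := fun ω => ∑ i, mulVecL (B i) (messages x η k ω i)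
  have hz : MemLp z 2 μ :=
    memLp_sum_mulVecL hYm B
  set E : Ω → Vec p := fun ω => x k.castSucc ω - z ω
  have hE : MemLp E 2 μ := hX.sub hz
  have hEm : Measurable E := by
    refine (hx.measurable_state _).sub (Finset.measurable_fun_sum _ fun i _ => ?_)
    exact (mulVecL (B i)).continuous.measurable.comp
      ((measurable_pi_apply i).comp (measurable_messages hx hη k))
  -- The error and the messages are jointly Gaussian, hence independent.
  have hgauss : HasGaussianLaw (fun ω => (E ω, messages x η k ω)) μ := by
    let T : (i : Fin (k + 1)) → (Fin (n + 1) → Vec p) →L[ℝ] Vec p := fun i =>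
      (mulVecL (L ⟨i, by omega⟩)ᵀ).comp (ContinuousLinearMap.proj (⟨i, by omega⟩ : Fin (n + 1)))
    have := hx.hasGaussianLaw_states.map
      ((ContinuousLinearMap.proj k.castSucc - ∑ i, (mulVecL (B i)).comp (T i)).prod
        (ContinuousLinearMap.pi T))
    refine this.congr (.of_forall fun ω => ?_)
    simp only [Function.comp_apply, ContinuousLinearMap.prod_apply, _root_.sub_apply,
      _root_.sum_apply, ContinuousLinearMap.proj_apply,
      ContinuousLinearMap.comp_apply]
    rfl
  have hind : IndepFun E (messages x η k) μ := by
    refine hgauss.indepFun_of_covariance_strongDual fun L₁ L₂ => ?_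
    have hsum : L₂ ∘ messages x η k = fun ω => ∑ i : Fin (k + 1),
        L₂.comp (ContinuousLinearMap.single ℝ (fun _ => Vec p) i) (messages x η k ω i) := by
      funext ω
      simp only [Function.comp_apply, ContinuousLinearMap.comp_apply,
        ContinuousLinearMap.single_apply]
      rw [← map_sum, Finset.univ_sum_single]
    rw [hsum, covariance_fun_sum_right (X := fun (i : Fin (k + 1)) ω =>
      L₂.comp (ContinuousLinearMap.single ℝ (fun _ => Vec p) i) (messages x η k ω i))
      (fun i => ContinuousLinearMap.comp_memLp' _ (hYm i))
      (ContinuousLinearMap.comp_memLp' _ hE)]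
    refine Finset.sum_eq_zero fun i _ => ?_
    have := covariance_inner_inner hE (hY ⟨i, by omega⟩)
      ((InnerProductSpace.toDual ℝ (Vec p)).symm L₁) ((InnerProductSpace.toDual ℝ (Vec p)).symm
        (L₂.comp (ContinuousLinearMap.single ℝ (fun _ => Vec p) i)))
    rw [hB i] at this
    simp only [InnerProductSpace.toDual_symm_apply, Matrix.zero_mulVec, dotProduct_zero] at this
    exact this
  have hE0 : ∫ ω, E ω ∂μ = 0 := by
    have hi := hX.integrable one_le_two
    have hint : ∀ i : Fin (k + 1),
        Integrable (fun ω => mulVecL (B i) (messages x η k ω i)) μ := fun i =>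
      (memLp_mulVecL (B i) (hYm i)).integrable one_le_two
    have hzero : ∀ i : Fin (k + 1), ∫ ω, mulVecL (B i) (messages x η k ω i) ∂μ = 0 := fun i => by
      rw [ContinuousLinearMap.integral_comp_comm _ ((hYm i).integrable one_le_two)]
      change mulVecL (B i) (∫ ω, mulVecL (L ⟨i, by omega⟩)ᵀ (x ⟨i, by omega⟩ ω) ∂μ) = 0
      rw [ContinuousLinearMap.integral_comp_comm _ ((hx.memLp_state _).integrable one_le_two),
        hx.integral_state, map_zero, map_zero]
    rw [integral_sub hi (hz.integrable one_le_two), hx.integral_state,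
      integral_finsetSum _ fun i _ => hint i, Finset.sum_eq_zero fun i _ => hzero i, sub_zero]
  have hcE : μ[E | messageSigma x η k] =ᵐ[μ] fun _ => 0 := by
    have := condExp_indep_eq hEm.comap_le (messageSigma_le hx hη k)
      (comap_measurable E).stronglyMeasurable hind
    rwa [hE0] at this
  have hzm : StronglyMeasurable[messageSigma x η k] z := by
    have hφ : Measurable fun v : Fin (k + 1) → Vec p => ∑ i, mulVecL (B i) (v i) :=
      Finset.measurable_fun_sum _ fun i _ =>
        (mulVecL (B i)).continuous.measurable.comp (measurable_pi_apply i)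
    exact (hφ.comp (comap_measurable (messages x η k))).stronglyMeasurable
  have hcz : μ[z | messageSigma x η k] = z :=
    condExp_of_stronglyMeasurable (messageSigma_le hx hη k) hzm (hz.integrable one_le_two)
  have hxe : x k.castSucc = E + z := by
    funext ω
    simp [E]
  rw [posterior, hxe]
  filter_upwards [condExp_add (m := messageSigma x η k) (hE.integrable one_le_two)
    (hz.integrable one_le_two), hcE] with ω e1 e2
  rw [e1, Pi.add_apply, e2, zero_add, hcz]

/-- Under the optimal linear policy the posteriors are linear in the messages, and their
covariances are the given solution. -/
lemma posterior_memorylessLinear (hx : g.IsStateModel μ x w)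
    {S U D L : Fin n → Matrix (Fin p) (Fin p) ℝ} (hS : S ∈ g.sdpFeasible)
    (hP : ∀ k, (U k * D k * (U k)ᵀ).IsSymm) (hI : ∀ k, IsIdempotentElem (U k * D k * (U k)ᵀ))
    (hU : ∀ k, (U k)ᵀ * U k = 1)
    (hSP : ∀ k, S k = g.A * prev S k * g.Aᵀ +
      msqrt (g.gap S k) * (U k * D k * (U k)ᵀ) * msqrt (g.gap S k))
    (hL : ∀ k, L k = (msqrt (g.gap S k))⁻¹ * U k * D k) (k : Fin n) :
    posteriorCov μ x (memorylessLinear L) k = S k ∧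
    ∃ B : Fin (k + 1) → Matrix (Fin p) (Fin p) ℝ, posterior μ x (memorylessLinear L) k =ᵐ[μ]
      fun ω => ∑ i, mulVecL (B i) (messages x (memorylessLinear L) k ω i) := by
  obtain ⟨B, hB, hBY⟩ := hasLinearEstimate_messages hx hS hP hI hU hSP hL k k.2
  have hpost := posterior_ae_eq_of_uncorrelated hx L k B hBY
  refine ⟨?_, B, hpost⟩
  have hX := hx.memLp_state k.castSucc
  have hY := memLp_message hx L
  set z : Ω → Vec p := fun ω => ∑ i : Fin (k + 1),
    mulVecL (B i) (message x (memorylessLinear L) ⟨i, by omega⟩ ω)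
  have hz : MemLp z 2 μ := memLp_sum_mulVecL (fun i => hY _) B
  set E : Ω → Vec p := fun ω => x k.castSucc ω - z ω
  have hE : MemLp E 2 μ := hX.sub hz
  have hEz : crossCov μ E z = 0 := crossCov_sum_mulVecL_eq_zero hE (fun i => hY _) hBY B
  have hzE : crossCov μ z E = 0 := by rw [← transpose_crossCov, hEz, transpose_zero]
  have hEE : crossCov μ E E = g.stateCov k - S k := hB
  -- The state is the sum of the uncorrelated vectors `E` and `z`.
  have hsum : x k.castSucc = fun ω => E ω + z ω := by
    funext ω
    simp [E]
  have hs : MemLp (fun ω => E ω + z ω) 2 μ := hE.add hz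
  have hcov := hx.crossCov_state k.castSucc
  rw [hsum, crossCov_add_left hE hz hs, crossCov_add_right hE hz hE, crossCov_add_right hE hz hz,
    hEz, hzE, hEE] at hcov
  rw [posteriorCov_eq_crossCov, crossCov_congr hpost hpost]
  change crossCov μ z z = S k
  simp only [add_zero, zero_add, Fin.val_castSucc] at hcov
  rw [sub_add_eq_add_sub, sub_eq_iff_eq_add] at hcov
  exact add_left_cancel hcov

end Optimal

/-! ### Best responses and the cost of the sender -/

section Responses

variable {n p t r : ℕ} {g : Game n p t r} {Ω : Type*} [MeasurableSpace Ω] {μ : Measure Ω}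
  {x : Fin (n + 1) → Ω → Vec p} {w : Fin n → Ω → Vec p} {η : SenderPolicy n p}

lemma le_of_sum_le_sum_of_le {ι : Type*} [Fintype ι] {a b : ι → ENNReal} (hab : ∀ i, a i ≤ b i)
    (ha : ∀ i, a i ≠ ⊤) (h : ∑ i, b i ≤ ∑ i, a i) (k : ι) : b k ≤ a k := by
  classical
  rw [← Finset.add_sum_erase _ b (Finset.mem_univ k),
    ← Finset.add_sum_erase _ a (Finset.mem_univ k)] at h
  have hrest : ∑ i ∈ Finset.univ.erase k, a i ≠ ⊤ := ENNReal.sum_ne_top.2 fun i _ => ha i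
  refine ENNReal.le_of_add_le_add_right hrest (le_trans ?_ h)
  gcongr with i
  exact hab i

/-- The least-squares action of the receiver for the posterior `x̂_k`. -/
noncomputable def bestAction (g : Game n p t r) (μ : Measure Ω) (x : Fin (n + 1) → Ω → Vec p)
    (η : SenderPolicy n p) (k : Fin n) (ω : Ω) : Vec t :=
  mulVecL (lsGain (g.QR k) (g.RR k)) (posterior μ x η k ω)

lemma measurable_action (hx : g.IsStateModel μ x w) (hη : η.Admissible)
    {γ : ReceiverPolicy n p t} (hγ : γ.Admissible) (k : Fin n) : Measurable (action x η γ k) :=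
  (hγ k).comp (measurable_messages hx hη k)

/-- A sum of quadratic stage costs integrates to the sum of the expected stage costs. -/
lemma lintegral_sum_cost (hx : g.IsStateModel μ x w) (hη : η.Admissible)
    {γ : ReceiverPolicy n p t} (hγ : γ.Admissible) (Q : Fin n → Matrix (Fin r) (Fin p) ℝ)
    (R : Fin n → Matrix (Fin r) (Fin t) ℝ) :
    ∫⁻ ω, ∑ k : Fin n, ENNReal.ofReal (‖(WithLp.toLp 2 (Q k *ᵥ (x k.castSucc ω).ofLp +
      R k *ᵥ (action x η γ k ω).ofLp) : Vec r)‖ ^ 2) ∂μ =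
    ∑ k, ∫⁻ ω, ENNReal.ofReal
      (‖mulVecL (Q k) (x k.castSucc ω) + mulVecL (R k) (action x η γ k ω)‖ ^ 2) ∂μ := by
  refine lintegral_finsetSum _ fun k _ => ?_
  have h : Measurable fun ω =>
      mulVecL (Q k) (x k.castSucc ω) + mulVecL (R k) (action x η γ k ω) :=
    ((mulVecL (Q k)).continuous.measurable.comp (hx.measurable_state _)).add
      ((mulVecL (R k)).continuous.measurable.comp (measurable_action hx hη hγ k))
  exact (h.norm.pow_const 2).ennreal_ofReal

lemma lintegral_cost_congr {X : Ω → Vec p} {u v : Ω → Vec t} (h : u =ᵐ[μ] v)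
    (Q : Matrix (Fin r) (Fin p) ℝ) (R : Matrix (Fin r) (Fin t) ℝ) :
    ∫⁻ ω, ENNReal.ofReal (‖mulVecL Q (X ω) + mulVecL R (u ω)‖ ^ 2) ∂μ =
      ∫⁻ ω, ENNReal.ofReal (‖mulVecL Q (X ω) + mulVecL R (v ω)‖ ^ 2) ∂μ := by
  refine lintegral_congr_ae ?_
  filter_upwards [h] with ω e
  rw [e]

/-- The posterior is a measurable function of the messages. -/
lemma exists_posterior_eq_comp {k : ℕ} (X : Ω → Vec p) (Y : Ω → Fin (k + 1) → Vec p) :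
    ∃ h : (Fin (k + 1) → Vec p) → Vec p, Measurable h ∧
      μ[X | MeasurableSpace.comap Y inferInstance] = h ∘ Y := by
  obtain ⟨h, hm, he⟩ := (stronglyMeasurable_condExp (μ := μ) (f := X)
    (m := MeasurableSpace.comap Y inferInstance)).exists_eq_measurable_comp
  exact ⟨h, hm.measurable, he⟩

variable [IsProbabilityMeasure μ]

/-- The best responses are the policies that almost surely take the least-squares actions. -/
lemma isBestResponse_iff (hx : g.IsStateModel μ x w) (hη : η.Admissible)
    (γ : ReceiverPolicy n p t) :
    g.IsBestResponse μ x η γ ↔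
      γ.Admissible ∧ ∀ k, action x η γ k =ᵐ[μ] bestAction g μ x η k := by
  have hstage := fun k => lintegral_cost_isLeast (messageSigma_le hx hη k) (g.QR k)
    (g.posDef_RR k) (hx.memLp_state k.castSucc)
  have hmeas : ∀ {γ' : ReceiverPolicy n p t}, γ'.Admissible → ∀ k,
      AEStronglyMeasurable[messageSigma x η k] (action x η γ' k) μ := fun hγ' k =>
    ((hγ' k).comp (comap_measurable (messages x η k))).stronglyMeasurable.aestronglyMeasurable
  refine and_congr_right fun hγ => ⟨fun hmin => ?_, fun hbest γ' hγ' => ?_⟩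
  · choose h hh he using fun k : Fin n =>
      exists_posterior_eq_comp (μ := μ) (x k.castSucc) (messages x η k)
    let γ₀ : ReceiverPolicy n p t := fun k v => mulVecL (lsGain (g.QR k) (g.RR k)) (h k v)
    have hγ₀ : γ₀.Admissible := fun k =>
      (mulVecL (lsGain (g.QR k) (g.RR k))).continuous.measurable.comp (hh k)
    have hact : ∀ k, action x η γ₀ k = bestAction g μ x η k := fun k => by
      funext ω
      simp only [action, bestAction, posterior, he, γ₀, Function.comp_apply]
    have hle := hmin γ₀ hγ₀
    rw [Game.receiverCost, Game.receiverCost, lintegral_sum_cost hx hη hγ,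
      lintegral_sum_cost hx hη hγ₀] at hle
    simp only [hact] at hle
    -- No stage cost exceeds that of `γ`, and the sum is finite, so every stage cost is minimal.
    exact fun k => ((hstage k).2 _ (hmeas hγ k)).2 <| le_of_sum_le_sum_of_le
      (fun k => ((hstage k).2 _ (hmeas hγ k)).1) (fun k => (hstage k).1) hle k
  · rw [Game.receiverCost, Game.receiverCost, lintegral_sum_cost hx hη hγ,
      lintegral_sum_cost hx hη hγ']
    refine Finset.sum_le_sum fun k _ => ?_
    rw [lintegral_cost_congr (hbest k)]
    exact ((hstage k).2 _ (hmeas hγ' k)).1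

lemma quadratic_form_eq_V (g : Game n p t r) (k : Fin n) :
    (g.RS k * lsGain (g.QR k) (g.RR k))ᵀ * (g.RS k * lsGain (g.QR k) (g.RR k)) +
      (g.RS k * lsGain (g.QR k) (g.RR k))ᵀ * g.QS k +
      (g.QS k)ᵀ * (g.RS k * lsGain (g.QR k) (g.RR k)) = g.V k := by
  have h : g.RS k * lsGain (g.QR k) (g.RR k) = -g.lam k := by
    simp only [lsGain, Game.lam, Matrix.mul_neg, Matrix.mul_assoc]
  rw [h, Game.V, transpose_neg, Matrix.neg_mul, Matrix.mul_neg, neg_neg, Matrix.neg_mul,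
    Matrix.mul_neg]
  abel

/-- Against least-squares actions, the cost of the sender is an affine function of the reduced
objective. -/
lemma senderCost_eq (hx : g.IsStateModel μ x w) (hη : η.Admissible) {γ : ReceiverPolicy n p t}
    (hγ : γ.Admissible) (h : ∀ k, action x η γ k =ᵐ[μ] bestAction g μ x η k) :
    g.senderCost μ x η γ = ENNReal.ofReal
      (∑ k : Fin n, ∫ ω, ‖mulVecL (g.QS k) (x k.castSucc ω)‖ ^ 2 ∂μ +
        g.posteriorObjective μ x η) := by
  rw [Game.senderCost, lintegral_sum_cost hx hη hγ, Game.posteriorObjective,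
    ← Finset.sum_add_distrib]
  have hstage : ∀ k : Fin n, ∫ ω, ‖mulVecL (g.QS k) (x k.castSucc ω)‖ ^ 2 ∂μ +
      ∫ ω, (posterior μ x η k ω).ofLp ⬝ᵥ (g.V k *ᵥ (posterior μ x η k ω).ofLp) ∂μ =
      ∫ ω, ‖mulVecL (g.QS k) (x k.castSucc ω) +
        mulVecL (g.RS k) (bestAction g μ x η k ω)‖ ^ 2 ∂μ := fun k => by
    rw [← quadratic_form_eq_V]
    simp only [bestAction, ← mulVecL_mul]
    exact (integral_norm_sq_condExp (messageSigma_le hx hη k) _ _ (hx.memLp_state _)).symm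
  simp only [hstage]
  rw [ENNReal.ofReal_sum_of_nonneg fun k _ => integral_nonneg fun _ => sq_nonneg _]
  refine Finset.sum_congr rfl fun k _ => ?_
  rw [lintegral_cost_congr (h k)]
  exact lintegral_norm_sq ((memLp_mulVecL _ (hx.memLp_state _)).add
    (memLp_mulVecL _ (memLp_mulVecL _ (memLp_posterior hx η k))))

end Responses

end SignalingGame

/-! ### The Stackelberg equilibrium -/

open SignalingGame in
theorem mainTheorem1 {n p t r : ℕ} (g : Game n p t r)
    {Ω : Type*} [MeasurableSpace Ω] (μ : Measure Ω) [IsProbabilityMeasure μ]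
    (x : Fin (n + 1) → Ω → Vec p) (w : Fin n → Ω → Vec p) (hx : g.IsStateModel μ x w)
    (S P U D : Fin n → Matrix (Fin p) (Fin p) ℝ)
    (hS : g.IsSDPSolution S)
    (hP : ∀ k, (P k).IsSymm ∧ IsIdempotentElem (P k))
    (hSP : ∀ k, S k = g.A * prev S k * g.Aᵀ + msqrt (g.gap S k) * P k * msqrt (g.gap S k))
    (hU : ∀ k, U k ∈ Matrix.orthogonalGroup (Fin p) ℝ)
    (hD : ∀ k, (D k).IsDiag)
    (hPU : ∀ k, P k = U k * D k * (U k)ᵀ)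
    (L : Fin n → Matrix (Fin p) (Fin p) ℝ)
    (hL : ∀ k, L k = (msqrt (g.gap S k))⁻¹ * U k * D k) :
    -- the posterior covariances are the given solution
    (∀ k, posteriorCov μ x (memorylessLinear L) k = S k) ∧
    -- the lower bound is a lower bound for all policies, and it is attained
    (∀ η : SenderPolicy n p, η.Admissible → g.sdpObjective S ≤ g.posteriorObjective μ x η) ∧
    g.posteriorObjective μ x (memorylessLinear L) = g.sdpObjective S ∧
    -- the policies form a Stackelberg equilibrium with any reaction of the receiver
    (∀ Γ : SenderPolicy n p → ReceiverPolicy n p t, g.IsReaction μ x Γ →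
      g.IsStackelbergEquilibrium μ x (memorylessLinear L) Γ) ∧
    -- the best response to them is linear, and essentially unique
    ∃ G : (k : Fin n) → Fin (k + 1) → Matrix (Fin t) (Fin p) ℝ,
      (∀ γ : ReceiverPolicy n p t, g.IsBestResponse μ x (memorylessLinear L) γ →
        ∀ k, action x (memorylessLinear L) γ k
          =ᵐ[μ] action x (memorylessLinear L) (linearReceiver G) k) ∧
      -- some equilibrium consists of linear policies of both players
      ∃ Γ : SenderPolicy n p → ReceiverPolicy n p t, IsCausal Γ ∧
        Γ (memorylessLinear L) = linearReceiver G ∧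
        g.IsStackelbergEquilibrium μ x (memorylessLinear L) Γ := by
  have hopt := posterior_memorylessLinear hx hS.1 (fun k => hPU k ▸ (hP k).1)
    (fun k => hPU k ▸ (hP k).2) (fun k => (Matrix.mem_orthogonalGroup_iff' _ _).1 (hU k))
    (fun k => hPU k ▸ hSP k) hL
  have hη : (memorylessLinear L).Admissible := admissible_memorylessLinear L
  have hcov : posteriorCov μ x (memorylessLinear L) = S := funext fun k => (hopt k).1
  have hlower : ∀ η : SenderPolicy n p, η.Admissible →
      g.sdpObjective S ≤ g.posteriorObjective μ x η := fun η hη' => by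
    rw [posteriorObjective_eq hx hη']
    exact hS.2 (posteriorCov_mem_sdpFeasible hx hη')
  have hattained : g.posteriorObjective μ x (memorylessLinear L) = g.sdpObjective S := by
    rw [posteriorObjective_eq hx hη, hcov]
  have heq : ∀ Γ : SenderPolicy n p → ReceiverPolicy n p t, g.IsReaction μ x Γ →
      g.IsStackelbergEquilibrium μ x (memorylessLinear L) Γ := fun Γ hΓ => by
    refine ⟨hη, hΓ, fun η' hη' => ?_⟩
    obtain ⟨ha, hb⟩ := (isBestResponse_iff hx hη _).1 (hΓ _ hη)
    obtain ⟨ha', hb'⟩ := (isBestResponse_iff hx hη' _).1 (hΓ _ hη')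
    rw [senderCost_eq hx hη ha hb, senderCost_eq hx hη' ha' hb', hattained]
    exact ENNReal.ofReal_le_ofReal (add_le_add_right (hlower η' hη') _)
  refine ⟨fun k => (hopt k).1, hlower, hattained, heq, ?_⟩
  choose B hB using fun k => (hopt k).2
  set G : (k : Fin n) → Fin (k + 1) → Matrix (Fin t) (Fin p) ℝ :=
    fun k i => lsGain (g.QR k) (g.RR k) * B k i
  have hG : ∀ k, action x (memorylessLinear L) (linearReceiver G) k =ᵐ[μ]
      bestAction g μ x (memorylessLinear L) k := fun k => by
    filter_upwards [hB k] with ω e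
    rw [bestAction, e, map_sum]
    simp only [← mulVecL_mul]
    rfl
  have hGm : (linearReceiver G : ReceiverPolicy n p t).Admissible := fun k =>
    Finset.measurable_fun_sum _ fun i _ =>
      (mulVecL (G k i)).continuous.measurable.comp (measurable_pi_apply i)
  refine ⟨G, fun γ hγ k => (((isBestResponse_iff hx hη γ).1 hγ).2 k).trans (hG k).symm, ?_⟩
  choose h hh he using fun (k : Fin n) (Y : Ω → Fin (k + 1) → Vec p) =>
    exists_posterior_eq_comp (μ := μ) (x k.castSucc) Y
  -- The reaction depends on the sender's policy only through the messages as random variables,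
  -- and a policy with the messages of the linear one meets the linear response.
  classical
  let F : (k : Fin n) → (Ω → Fin (k + 1) → Vec p) → (Fin (k + 1) → Vec p) → Vec t := fun k Y =>
    if Y = messages x (memorylessLinear L) k then linearReceiver G k
    else fun v => mulVecL (lsGain (g.QR k) (g.RR k)) (h k Y v)
  let Γ : SenderPolicy n p → ReceiverPolicy n p t := fun η k => F k (messages x η k)
  have hΓlin : Γ (memorylessLinear L) = linearReceiver G := funext fun k => if_pos rfl
  refine ⟨Γ, fun k η η' hηη' => ?_, hΓlin, heq Γ fun η hη' => ?_⟩
  · have : messages x η k = messages x η' k := by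
      funext ω i
      simp only [messages, message]
      rw [hηη' ⟨i, by omega⟩ (Fin.le_def.2 (Nat.lt_succ_iff.1 i.2))]
    simp only [Γ, this]
  refine (isBestResponse_iff hx hη' _).2 ⟨fun k => ?_, fun k => ?_⟩ <;>
    by_cases hY : messages x η k = messages x (memorylessLinear L) k
  · have e : Γ η k = linearReceiver G k := if_pos hY
    exact e ▸ hGm k
  · have e : Γ η k = fun v => mulVecL (lsGain (g.QR k) (g.RR k)) (h k (messages x η k) v) :=
      if_neg hY
    rw [e]
    exact (mulVecL (lsGain (g.QR k) (g.RR k))).continuous.measurable.comp (hh k _)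
  · have e : Γ η k = linearReceiver G k := if_pos hY
    have e1 : action x η (Γ η) k = action x (memorylessLinear L) (linearReceiver G) k := by
      funext ω
      rw [action, action, e, hY]
    have e2 : bestAction g μ x η k = bestAction g μ x (memorylessLinear L) k := by
      funext ω
      rw [bestAction, bestAction, SignalingGame.posterior, SignalingGame.posterior, hY]
    rw [e1, e2]
    exact hG k
  · have e : Γ η k = fun v => mulVecL (lsGain (g.QR k) (g.RR k)) (h k (messages x η k) v) :=
      if_neg hY
    refine .of_forall fun ω => ?_
    rw [action, e, bestAction, SignalingGame.posterior, he]
    rfl
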